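/- Let $d,k,r\ge 0$ be integers (the assumptions force $d\ge1$ and $k\ge2$) and let $X_{ij}=(X_{ij1},\dots,X_{ijd})^\top$, $i=1,\dots,k$, $j=1,2,\dots$, be mutually independent $\mathbb R^d$-valued random vectors such that, for each $i$, all $X_{ij}$ have the same distribution, with $\mathbb E(X_{i1s}^4)<\infty$ for all $s$, mean vector $\mu_i\neq 0$ and nonsingular covariance matrix $\Sigma_i$. A coordinate $Y_s$ of a random vector $Y$ is called conditionally two-point distributed if, almost surely, the support of its conditional distribution given the remaining coordinates has at most two points. Assume that for every $i$ no coordinate of $X_{i1}$ is conditionally two-point distributed. Let the group sizes $n_1,\dots,n_k$ vary so that $n=\sum_{i=1}^k n_i\to\infty$ and $n_i/n\to\kappa_i\in(0,1)$ for each $i$; all limits are in this sense. Put $C_i=1/\sqrt{\mu_i^\top\Sigma_i^{-1}\mu_i}$, $B_i=\sqrt{\mu_i^\top\Sigma_i^{-1}\mu_i}$, $C=(C_1,\dots,C_k)^\top$, $B=(B_1,\dots,B_k)^\top$. Let $$\widehat\mu_i=\frac1{n_i}\sum_{j=1}^{n_i}X_{ij},\qquad \widehat\Sigma_i=\frac1{n_i}\sum_{j=1}^{n_i}(X_{ij}-\widehat\mu_i)(X_{ij}-\widehat\mu_i)^\top,$$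 let $\widehat C_i,\widehat B_i$ be obtained from $C_i,B_i$ by replacing $\mu_i,\Sigma_i$ by $\widehat\mu_i,\widehat\Sigma_i$, and $\widehat C=(\widehat C_1,\dots,\widehat C_k)^\top$, $\widehat B=(\widehat B_1,\dots,\widehat B_k)^\top$. For $\mu\in\mathbb R^d$ and a nonsingular covariance matrix $\Sigma$ define the row vector of length $d+d^2$ $$A(\mu,\Sigma)=\Bigl(2\mu^\top\Sigma^{-1}-[(\mu^\top\Sigma^{-1})\otimes(\mu^\top\Sigma^{-1})]\widetilde D(\mu),\; -(\mu^\top\Sigma^{-1})\otimes(\mu^\top\Sigma^{-1})\Bigr),$$ where $\widetilde D(x)\in\mathbb R^{d^2\times d}$ has entries $$[\widetilde D(x)]_{ad-d+q,s}=-x_q\mathbf 1\{s=a\ne q\}-2x_s\mathbf 1\{s=q=a\}-x_a\mathbf 1\{q=s\ne a\},\qquad a,q,s\in\{1,\dots,d\}.$$ Writing $\langle Z\rangle_i$ for the average $n_i^{-1}\sum_{j=1}^{n_i}Z_{ij}$, let $\widehat\Psi_{i3}\in\mathbb R^{d^2\times d}$ and $\widehat\Psi_{i4}\in\mathbb R^{d^2\times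 d^2}$ be given by $$[\widehat\Psi_{i3}]_{ad-d+q,s}=\langle X_{a}X_{q}X_{s}\rangle_i-\langle X_{a}X_{q}\rangle_i\langle X_{s}\rangle_i,\qquad [\widehat\Psi_{i4}]_{ad-d+q,bd-d+s}=\langle X_{a}X_{q}X_{b}X_{s}\rangle_i-\langle X_{a}X_{q}\rangle_i\langle X_{b}X_{s}\rangle_i ,$$ and put $$\widehat\sigma_{i,C}^2=\frac{n(\widehat\mu_i^\top\widehat\Sigma_i^{-1}\widehat\mu_i)^{-3}}{4n_i}\,A(\widehat\mu_i,\widehat\Sigma_i)\begin{pmatrix}\widehat\Sigma_i&\widehat\Psi_{i3}^\top\\ \widehat\Psi_{i3}&\widehat\Psi_{i4}\end{pmatrix}A(\widehat\mu_i,\widehat\Sigma_i)^\top,\qquad \widehat\sigma_{i,B}^2=(\widehat\mu_i^\top\widehat\Sigma_i^{-1}\widehat\mu_i)^2\,\widehat\sigma_{i,C}^2,$$ $\widehat\Sigma_C=\operatorname{diag}(\widehat\sigma^2_{1,C},\dots,\widehat\sigma^2_{k,C})$ and $\widehat\Sigma_B=\operatorname{diag}(\widehat\sigma^2_{1,B},\dots,\widehat\sigma^2_{k,B})$.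 (Where an expression is undefined because of an empty group, a singular $\widehat\Sigma_i$ or a division by zero, any inverse or quotient that does not exist is set to $0$.) Let $H\in\mathbb R^{r\times k}$ be a contrast matrix, i.e. $H\mathbf 1=0$, let $^+$ denote the Moore--Penrose inverse, and let $T=H^\top(HH^\top)^+H$. For a matrix $M$ with $k$ columns put $$S_{n,C}(M)=n(M\widehat C)^\top(M\widehat\Sigma_CM^\top)^+M\widehat C,\qquad S_{n,B}(M)=n(M\widehat B)^\top(M\widehat\Sigma_BM^\top)^+M\widehat B .$$ Let $\chi^2_p$ be the distribution of the sum of squares of $p$ independent standard normal variables (the point mass at $0$ if $p=0$). Then: (i) Under $\mathcal H_{0,C}:TC=0$, $S_{n,C}(T)$ converges in distribution to $\chi^2_{\operatorname{rank}(T)}$. (ii) Under $\mathcal H_{0,B}:TB=0$, $S_{n,B}(T)$ converges in distribution to $\chi^2_{\operatorname{rank}(T)}$. Both statements also hold with the contrast matrix $H$ in place of $T$. -/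

import Mathlib

open MeasureTheory ProbabilityTheory Filter Topology Matrix

namespace MCV

noncomputable section

/-! ### Moore--Penrose inverse of a real matrix -/

/-- The four Penrose equations: `X` is the Moore--Penrose inverse of the real matrix `A`. -/
structure IsMoorePenrose {p q : ℕ} (A : Matrix (Fin p) (Fin q) ℝ)
    (X : Matrix (Fin q) (Fin p) ℝ) : Prop where
  mul_inv_mul : A * X * A = A
  inv_mul_inv : X * A * X = X
  symm_left : (A * X)ᵀ = A * X
  symm_right : (X * A)ᵀ = X * A

theorem IsMoorePenrose.unique {p q : ℕ} {A : Matrix (Fin p) (Fin q) ℝ}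
    {X Y : Matrix (Fin q) (Fin p) ℝ} (hX : IsMoorePenrose A X) (hY : IsMoorePenrose A Y) :
    X = Y := by
  have h1 : A * X = A * Y := by
    calc A * X = (A * Y * A) * X := by rw [hY.mul_inv_mul]
      _ = (A * Y) * (A * X) := by simp only [Matrix.mul_assoc]
      _ = (A * Y)ᵀ * (A * X)ᵀ := by rw [hX.symm_left, hY.symm_left]
      _ = ((A * X * A) * Y)ᵀ := by
          rw [← Matrix.transpose_mul]; simp only [Matrix.mul_assoc]
      _ = A * Y := by rw [hX.mul_inv_mul, hY.symm_left]
  have h2 : X * A = Y * A := by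
    calc X * A = X * (A * Y * A) := by rw [hY.mul_inv_mul]
      _ = (X * A) * (Y * A) := by simp only [Matrix.mul_assoc]
      _ = (X * A)ᵀ * (Y * A)ᵀ := by rw [hX.symm_right, hY.symm_right]
      _ = (Y * (A * X * A))ᵀ := by
          rw [← Matrix.transpose_mul]; simp only [Matrix.mul_assoc]
      _ = Y * A := by rw [hX.mul_inv_mul, hY.symm_right]
  calc X = X * A * X := hX.inv_mul_inv.symm
    _ = Y * (A * X) := by rw [h2, Matrix.mul_assoc]
    _ = Y := by rw [h1, ← Matrix.mul_assoc, hY.inv_mul_inv]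

theorem exists_isMoorePenrose {p q : ℕ} (A : Matrix (Fin p) (Fin q) ℝ) :
    ∃ X, IsMoorePenrose A X := by
  have hB : (Aᵀ * A).IsHermitian := by
    simpa using Matrix.isHermitian_conjTranspose_mul_self A
  set U : Matrix (Fin q) (Fin q) ℝ := (hB.eigenvectorUnitary : Matrix (Fin q) (Fin q) ℝ) with hU
  set v : Fin q → ℝ := hB.eigenvalues with hv
  have hUU : Uᵀ * U = 1 := by
    have := Unitary.coe_star_mul_self hB.eigenvectorUnitary
    simpa [Matrix.star_eq_conjTranspose] using this
  have hspec : Aᵀ * A = U * diagonal v * Uᵀ := by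
    have := hB.spectral_theorem
    simpa [Unitary.conjStarAlgAut_apply, Matrix.star_eq_conjTranspose, Function.comp_def] using this
  have hmul : ∀ a b : Fin q → ℝ,
      (U * diagonal a * Uᵀ) * (U * diagonal b * Uᵀ) = U * diagonal (fun i => a i * b i) * Uᵀ := by
    intro a b
    calc _ = U * diagonal a * (Uᵀ * U) * diagonal b * Uᵀ := by simp only [Matrix.mul_assoc]
      _ = _ := by rw [hUU, Matrix.mul_one, Matrix.mul_assoc U, diagonal_mul_diagonal]
  have htr : ∀ a : Fin q → ℝ, (U * diagonal a * Uᵀ)ᵀ = U * diagonal a * Uᵀ := by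
    intro a
    simp [Matrix.transpose_mul, Matrix.mul_assoc]
  set P : Matrix (Fin q) (Fin q) ℝ := U * diagonal (fun i => (v i)⁻¹) * Uᵀ with hP
  have hPB : P * (Aᵀ * A) = U * diagonal (fun i => (v i)⁻¹ * v i) * Uᵀ := by
    rw [hspec, hP, hmul]
  have hPsymm : Pᵀ = P := htr _
  have hPBsymm : (P * (Aᵀ * A))ᵀ = P * (Aᵀ * A) := by rw [hPB, htr]
  have hPBP : P * (Aᵀ * A) * P = P := by
    rw [hPB, hP, hmul]
    congr 3
    funext i
    by_cases h : v i = 0 <;> simp [h]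
  have hBPB : Aᵀ * A * (P * (Aᵀ * A)) = Aᵀ * A := by
    rw [hPB, hspec, hmul]
    congr 3
    funext i
    by_cases h : v i = 0 <;> simp [h]
  have hA : A * (P * (Aᵀ * A)) = A := by
    have h0 : A * (P * (Aᵀ * A) - 1) = 0 := by
      apply Matrix.conjTranspose_mul_self_eq_zero.mp
      have : Aᵀ * (A * (P * (Aᵀ * A) - 1)) = 0 := by
        rw [← Matrix.mul_assoc, Matrix.mul_sub, hBPB, Matrix.mul_one, sub_self]
      rw [Matrix.conjTranspose_mul, Matrix.mul_assoc]
      simp [this]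
    rw [Matrix.mul_sub, Matrix.mul_one, sub_eq_zero] at h0
    exact h0
  refine ⟨P * Aᵀ, ?_, ?_, ?_, ?_⟩
  · calc A * (P * Aᵀ) * A = A * (P * (Aᵀ * A)) := by simp only [Matrix.mul_assoc]
      _ = A := hA
  · calc P * Aᵀ * A * (P * Aᵀ) = (P * (Aᵀ * A) * P) * Aᵀ := by simp only [Matrix.mul_assoc]
      _ = P * Aᵀ := by rw [hPBP]
  · simp [Matrix.transpose_mul, hPsymm, Matrix.mul_assoc]
  · rw [Matrix.mul_assoc, hPBsymm]

/-- The Moore--Penrose inverse `A⁺`. -/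
def pinv {p q : ℕ} (A : Matrix (Fin p) (Fin q) ℝ) : Matrix (Fin q) (Fin p) ℝ :=
  (exists_isMoorePenrose A).choose

theorem pinv_spec {p q : ℕ} (A : Matrix (Fin p) (Fin q) ℝ) : IsMoorePenrose A (pinv A) :=
  (exists_isMoorePenrose A).choose_spec

/-- The projection matrix `T = Hᵀ (H Hᵀ)⁺ H` associated with `H`. -/
def projMat {r k : ℕ} (H : Matrix (Fin r) (Fin k) ℝ) : Matrix (Fin k) (Fin k) ℝ :=
  Hᵀ * pinv (H * Hᵀ) * H

/-! ### The chi-square distribution -/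

/-- The chi-square distribution with `p` degrees of freedom: the law of the sum of squares of `p`
independent standard normal variables (a point mass at `0` if `p = 0`). -/
def chiSquare (p : ℕ) : Measure ℝ :=
  (Measure.pi fun _ : Fin p => gaussianReal 0 1).map fun z => ∑ i, z i ^ 2

instance (p : ℕ) : IsProbabilityMeasure (chiSquare p) :=
  Measure.isProbabilityMeasure_map
    (Measurable.aemeasurable (Finset.measurable_sum _ fun i _ => (measurable_pi_apply i).pow_const 2))

/-! ### Population quantities of a random vector -/

section Population

variable {Ω : Type*} [MeasurableSpace Ω] {d : ℕ}

/-- Expectation vector. -/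
def popMean (P : Measure Ω) (Y : Ω → Fin d → ℝ) : Fin d → ℝ := fun r => ∫ ω, Y ω r ∂P

/-- Covariance matrix. -/
def popCov (P : Measure Ω) (Y : Ω → Fin d → ℝ) : Matrix (Fin d) (Fin d) ℝ :=
  Matrix.of fun r s => covariance (fun ω => Y ω r) (fun ω => Y ω s) P

/-- The `r`-th coordinate of `Y` is conditionally two-point distributed: for almost every value of
the remaining coordinates, the support of the conditional distribution of `Y_r` given these
coordinates has at most two points. -/
def IsCondTwoPoint (P : Measure Ω) [IsFiniteMeasure P] (Y : Ω → Fin d → ℝ) (r : Fin d) : Prop :=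
  ∀ᵐ y ∂(P.map fun ω (s : {s : Fin d // s ≠ r}) => Y ω s),
    (condDistrib (fun ω => Y ω r) (fun ω (s : {s : Fin d // s ≠ r}) => Y ω s) P y).support.encard
      ≤ 2

end Population

/-! ### Functionals of a mean vector and a covariance matrix -/

section Functionals

variable {d : ℕ}

/-- The quadratic form `μᵀ Σ⁻¹ μ`. -/
def quadForm (m : Fin d → ℝ) (S : Matrix (Fin d) (Fin d) ℝ) : ℝ := m ⬝ᵥ (S⁻¹ *ᵥ m)

/-- Multivariate coefficient of variation `1 / √(μᵀ Σ⁻¹ μ)`. -/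
def coefVar (m : Fin d → ℝ) (S : Matrix (Fin d) (Fin d) ℝ) : ℝ := 1 / √(quadForm m S)

/-- Multivariate standardized mean `√(μᵀ Σ⁻¹ μ)`. -/
def stdMean (m : Fin d → ℝ) (S : Matrix (Fin d) (Fin d) ℝ) : ℝ := √(quadForm m S)

/-- The `d² × d` matrix `D̃(x)`. The pair `(a, r)` stands for the row index `ad - d + r`. -/
def Dtilde (x : Fin d → ℝ) : Matrix (Fin d × Fin d) (Fin d) ℝ :=
  Matrix.of fun ar s =>
    -(if s = ar.1 ∧ ar.1 ≠ ar.2 then x ar.2 else 0)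
      - (if s = ar.2 ∧ ar.2 = ar.1 then 2 * x s else 0)
      - (if ar.2 = s ∧ s ≠ ar.1 then x ar.1 else 0)

/-- The Kronecker product `u ⊗ v` of two row vectors. -/
def kronVec (u v : Fin d → ℝ) : Fin d × Fin d → ℝ := fun ar => u ar.1 * v ar.2

/-- The row vector
`A(μ, Σ) = (2 μᵀΣ⁻¹ - [(μᵀΣ⁻¹) ⊗ (μᵀΣ⁻¹)] D̃(μ),  -(μᵀΣ⁻¹) ⊗ (μᵀΣ⁻¹))`. -/
def Avec (m : Fin d → ℝ) (S : Matrix (Fin d) (Fin d) ℝ) : Fin d ⊕ (Fin d × Fin d) → ℝ :=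
  Sum.elim
    ((2 : ℝ) • (m ᵥ* S⁻¹) - kronVec (m ᵥ* S⁻¹) (m ᵥ* S⁻¹) ᵥ* Dtilde m)
    (-kronVec (m ᵥ* S⁻¹) (m ᵥ* S⁻¹))

end Functionals

/-! ### Empirical quantities of one sample `x 0, …, x (n - 1)` -/

section Sample

variable {d : ℕ}

/-- Arithmetic mean of `f 0, …, f (n - 1)`. -/
def avg (n : ℕ) (f : ℕ → ℝ) : ℝ := (n : ℝ)⁻¹ * ∑ j ∈ Finset.range n, f j

def empMean (n : ℕ) (x : ℕ → Fin d → ℝ) : Fin d → ℝ := fun r => avg n fun j => x j r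

def empCov (n : ℕ) (x : ℕ → Fin d → ℝ) : Matrix (Fin d) (Fin d) ℝ :=
  Matrix.of fun r s => avg n fun j => (x j r - empMean n x r) * (x j s - empMean n x s)

def empPsi3 (n : ℕ) (x : ℕ → Fin d → ℝ) : Matrix (Fin d × Fin d) (Fin d) ℝ :=
  Matrix.of fun ar s =>
    avg n (fun j => x j ar.1 * x j ar.2 * x j s)
      - avg n (fun j => x j ar.1 * x j ar.2) * avg n (fun j => x j s)

def empPsi4 (n : ℕ) (x : ℕ → Fin d → ℝ) : Matrix (Fin d × Fin d) (Fin d × Fin d) ℝ :=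
  Matrix.of fun ar bs =>
    avg n (fun j => x j ar.1 * x j ar.2 * x j bs.1 * x j bs.2)
      - avg n (fun j => x j ar.1 * x j ar.2) * avg n (fun j => x j bs.1 * x j bs.2)

/-- `μ̂ᵀ Σ̂⁻¹ μ̂`. -/
def empQuad (n : ℕ) (x : ℕ → Fin d → ℝ) : ℝ := quadForm (empMean n x) (empCov n x)

/-- The estimator of the asymptotic variance of `Ĉ`; `N` is the total sample size and `n` the size
of the group. -/
def varC (N n : ℕ) (x : ℕ → Fin d → ℝ) : ℝ :=
  (N : ℝ) * ((empQuad n x) ^ 3)⁻¹ / (4 * (n : ℝ)) *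
    (Avec (empMean n x) (empCov n x) ⬝ᵥ
      (Matrix.fromBlocks (empCov n x) (empPsi3 n x)ᵀ (empPsi3 n x) (empPsi4 n x) *ᵥ
        Avec (empMean n x) (empCov n x)))

/-- The estimator of the asymptotic variance of `B̂`. -/
def varB (N n : ℕ) (x : ℕ → Fin d → ℝ) : ℝ := empQuad n x ^ 2 * varC N n x

end Sample

/-! ### The Wald-type statistics

`n i` is the size of group `i`, and `x i j` is observation `j` of group `i`, for `j < n i`. -/

section Wald

variable {d k p : ℕ}

/-- The vector `Ĉ`. -/
def CHat (n : Fin k → ℕ) (x : Fin k → ℕ → Fin d → ℝ) : Fin k → ℝ :=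
  fun i => coefVar (empMean (n i) (x i)) (empCov (n i) (x i))

/-- The vector `B̂`. -/
def BHat (n : Fin k → ℕ) (x : Fin k → ℕ → Fin d → ℝ) : Fin k → ℝ :=
  fun i => stdMean (empMean (n i) (x i)) (empCov (n i) (x i))

def SigmaCHat (n : Fin k → ℕ) (x : Fin k → ℕ → Fin d → ℝ) : Matrix (Fin k) (Fin k) ℝ :=
  Matrix.diagonal fun i => varC (∑ l, n l) (n i) (x i)

def SigmaBHat (n : Fin k → ℕ) (x : Fin k → ℕ → Fin d → ℝ) : Matrix (Fin k) (Fin k) ℝ :=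
  Matrix.diagonal fun i => varB (∑ l, n l) (n i) (x i)

/-- The quadratic form `N (M v)ᵀ (M S Mᵀ)⁺ (M v)`. -/
def wald (N : ℕ) (M : Matrix (Fin p) (Fin k) ℝ) (S : Matrix (Fin k) (Fin k) ℝ) (v : Fin k → ℝ) :
    ℝ :=
  (N : ℝ) * ((M *ᵥ v) ⬝ᵥ (pinv (M * S * Mᵀ) *ᵥ (M *ᵥ v)))

/-- The statistic `S_{n,C}(M)`. -/
def waldC (M : Matrix (Fin p) (Fin k) ℝ) (n : Fin k → ℕ) (x : Fin k → ℕ → Fin d → ℝ) : ℝ :=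
  wald (∑ l, n l) M (SigmaCHat n x) (CHat n x)

/-- The statistic `S_{n,B}(M)`. -/
def waldB (M : Matrix (Fin p) (Fin k) ℝ) (n : Fin k → ℕ) (x : Fin k → ℕ → Fin d → ℝ) : ℝ :=
  wald (∑ l, n l) M (SigmaBHat n x) (BHat n x)

end Wald

end

end MCV

open MCV

/-!
The statistics are functions of the group-wise quadratic forms `q̂ᵢ = μ̂ᵢᵀ Σ̂ᵢ⁻¹ μ̂ᵢ`. With
`w = Σ⁻¹ μ` the identity
`m̂ᵀ Σ̂⁻¹ m̂ = 2 w·m̂ - w·Σ̂w + (m̂ - Σ̂w)·Σ̂⁻¹(m̂ - Σ̂w)` (`quadForm_eq_add`) shows that `q̂ - q` is the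
average of the influence function `2(Y - q) - (Y - q)² + q`, `Y = w·X`, up to products of two centred
averages. These are `o_P(N^(-1/2))` by Chebyshev's inequality
(`tendsto_empQuad_sub_avg_influence`), and the central limit theorem applies to the average itself.
Since `1/√a - 1/√q` and `√a - √q` are multiples of `a - q` with continuous factors, `√N (Ĉᵢ - Cᵢ)` and
`√N (B̂ᵢ - Bᵢ)` are, up to `o_P(1)`, products of a factor converging in probability and an
asymptotically standard normal variable, independent over the groups.

The form `A(μ, Σ)` applied to `(x, x ⊗ x)` equals the influence function up to a constant, and the block
matrix is the covariance matrix of `(X, X ⊗ X)`. The estimated variances are therefore consistent for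
the asymptotic ones (`tendsto_varC`, `tendsto_varB`). The latter are positive: a constant influence
function would confine `w·X` to two values, so a coordinate with nonzero weight would be
conditionally two-point distributed (`quadForm_pos_and_variance_influence_pos`).

Finally, with positive limiting variances a rank factorization turns the Moore--Penrose inverse
into an ordinary inverse, continuous at the limit, and Slutsky's theorem identifies the limit of the
Wald statistic as the squared length of a projection of a standard normal vector onto a subspace
of dimension `rank M` (`tendstoInDistribution_wald`). This holds for every matrix `M` annihilating
the parameter vector, in particular for `T` and `H`. Convergence in probability is expressed through
a filter on `ℕ × Ω` (`probFilter`).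
-/

namespace MCV

/-! ### Convergence in probability as convergence along a filter -/

section ConvergenceInProbability

variable {Ω : Type*} [MeasurableSpace Ω]

/-- The filter of convergence in probability on `ℕ × Ω`: a set belongs to it if the probability
that `(m, ω)` lies outside tends to `0` as `m → ∞`. Thus `fun z => V z.1 z.2` tends to `c` along
this filter iff `V m` converges to `c` in probability, and an event holds eventually along it iff it
holds with probability tending to one, so that the calculus of limits along filters replaces the
usual arguments with `o_P(1)` terms. -/
def probFilter (P : Measure Ω) : Filter (ℕ × Ω) where
  sets := {S | Tendsto (fun m => P {ω | (m, ω) ∉ S}) atTop (𝓝 0)}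
  univ_sets := by simp
  sets_of_superset {S T} hS hST :=
    tendsto_of_tendsto_of_tendsto_of_le_of_le tendsto_const_nhds hS (fun _ => zero_le)
      fun _ => measure_mono fun _ h h' => h (hST h')
  inter_sets {S T} hS hT := by
    have h := Tendsto.add hS hT
    rw [add_zero] at h
    refine tendsto_of_tendsto_of_tendsto_of_le_of_le tendsto_const_nhds h (fun _ => zero_le)
      fun m => (measure_mono ?_).trans (measure_union_le _ _)
    intro ω hω
    by_contra hc
    simp only [Set.mem_union, Set.mem_ofPred_eq, not_or, not_not] at hc
    exact hω hc

theorem eventually_probFilter {P : Measure Ω} {p : ℕ × Ω → Prop} :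
    (∀ᶠ z in probFilter P, p z) ↔ Tendsto (fun m => P {ω | ¬ p (m, ω)}) atTop (𝓝 0) :=
  Iff.rfl

theorem tendsto_fst_probFilter (P : Measure Ω) :
    Tendsto (Prod.fst : ℕ × Ω → ℕ) (probFilter P) atTop := by
  intro S hS
  change Tendsto (fun m => P {ω | ¬ m ∈ S}) atTop (𝓝 0)
  refine tendsto_const_nhds.congr' ?_
  filter_upwards [hS] with m hm
  simp [hm]

theorem tendstoInMeasure_iff_tendsto_probFilter {E : Type*} [PseudoMetricSpace E] {P : Measure Ω}
    {V : ℕ → Ω → E} {c : E} :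
    TendstoInMeasure P V atTop (fun _ => c) ↔
      Tendsto (fun z : ℕ × Ω => V z.1 z.2) (probFilter P) (𝓝 c) := by
  rw [tendstoInMeasure_iff_dist, Metric.tendsto_nhds]
  simp only [eventually_probFilter, not_lt]

theorem tendsto_probFilter_of_ae {P : Measure Ω} [IsFiniteMeasure P] {V : ℕ → Ω → ℝ}
    (hV : ∀ m, Measurable (V m)) {c : ℝ} (h : ∀ᵐ ω ∂P, Tendsto (fun m => V m ω) atTop (𝓝 c)) :
    Tendsto (fun z : ℕ × Ω => V z.1 z.2) (probFilter P) (𝓝 c) :=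
  tendstoInMeasure_iff_tendsto_probFilter.1
    (tendstoInMeasure_of_tendsto_ae (fun m => (hV m).aestronglyMeasurable) h)

/-! ### Averages of independent, identically distributed variables -/

variable {E : Type*} [MeasurableSpace E]

theorem measurable_avg {V : ℕ → Ω → ℝ} (hV : ∀ j, Measurable (V j)) (n : ℕ) :
    Measurable fun ω => avg n fun j => V j ω :=
  (Finset.measurable_sum _ fun j _ => hV j).const_mul _

/-- The measurable random elements `Y 0, Y 1, …` are independent and identically distributed. -/
structure IsIIDSample (P : Measure Ω) (Y : ℕ → Ω → E) : Prop where
  measurable : ∀ j, Measurable (Y j)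
  indep : iIndepFun Y P
  ident : ∀ j, IdentDistrib (Y j) (Y 0) P P

theorem IsIIDSample.comp {F : Type*} [MeasurableSpace F] {P : Measure Ω} {Y : ℕ → Ω → E}
    (hY : IsIIDSample P Y) {f : E → F} (hf : Measurable f) :
    IsIIDSample P fun j ω => f (Y j ω) where
  measurable j := hf.comp (hY.measurable j)
  indep := hY.indep.comp (fun _ => f) fun _ => hf
  ident j := (hY.ident j).comp hf

variable {P : Measure Ω}

/-- The law of large numbers along arbitrary sample sizes `s m → ∞`. -/
theorem IsIIDSample.tendsto_avg [IsProbabilityMeasure P] {V : ℕ → Ω → ℝ} (hV : IsIIDSample P V)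
    (hint : Integrable (V 0) P) {s : ℕ → ℕ} (hs : Tendsto s atTop atTop) :
    Tendsto (fun z : ℕ × Ω => avg (s z.1) fun j => V j z.2) (probFilter P) (𝓝 (∫ ω, V 0 ω ∂P)) := by
  refine tendsto_probFilter_of_ae (V := fun m ω => avg (s m) fun j => V j ω)
    (fun m => measurable_avg hV.measurable _) ?_
  have h := strong_law_ae_real V hint (fun i j hij => hV.indep.indepFun hij) hV.ident
  filter_upwards [h] with ω hω
  refine (hω.comp hs).congr fun m => ?_
  simp [avg, div_eq_inv_mul]

theorem IsIIDSample.variance_avg {V : ℕ → Ω → ℝ} (hV : IsIIDSample P V)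
    (hint : MemLp (V 0) 2 P) (n : ℕ) :
    Var[fun ω => avg n fun j => V j ω; P] = (n : ℝ)⁻¹ * Var[V 0; P] := by
  have hm : ∀ j, MemLp (V j) 2 P := fun j => (hV.ident j).memLp_iff.2 hint
  have h := IndepFun.variance_sum (s := Finset.range n) (fun j _ => hm j)
    (fun i _ j _ hij => hV.indep.indepFun hij)
  have h2 : (fun ω => avg n fun j => V j ω) = fun ω => (n : ℝ)⁻¹ * (∑ j ∈ Finset.range n, V j) ω := by
    funext ω; simp [avg]
  rw [h2, variance_const_mul, h, Finset.sum_congr rfl fun j _ => (hV.ident j).variance_eq]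
  rcases eq_or_ne n 0 with rfl | hn
  · simp
  · have : (n : ℝ) ≠ 0 := by exact_mod_cast hn
    simp; field_simp

/-- Chebyshev's inequality: centred averages over `s m` observations stay negligible in probability
when multiplied by factors of smaller order than `√(s m)`. -/
theorem IsIIDSample.tendsto_mul_avg_zero [IsProbabilityMeasure P] {V : ℕ → Ω → ℝ} (hV : IsIIDSample P V)
    (hint : MemLp (V 0) 2 P) (h0 : ∫ ω, V 0 ω ∂P = 0) {s : ℕ → ℕ} {a : ℕ → ℝ}
    (ha : Tendsto (fun m => a m ^ 2 * (s m : ℝ)⁻¹) atTop (𝓝 0)) :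
    Tendsto (fun z : ℕ × Ω => a z.1 * avg (s z.1) fun j => V j z.2) (probFilter P) (𝓝 0) := by
  rw [← tendstoInMeasure_iff_tendsto_probFilter (V := fun m ω => a m * avg (s m) fun j => V j ω),
    tendstoInMeasure_iff_norm]
  intro ε hε
  have hm : ∀ j, MemLp (V j) 2 P := fun j => (hV.ident j).memLp_iff.2 hint
  have hmem : ∀ m, MemLp (fun ω => a m * avg (s m) fun j => V j ω) 2 P := fun m =>
    ((memLp_finsetSum _ fun j _ => hm j).const_mul _).const_mul _
  have hmean : ∀ m, ∫ ω, a m * avg (s m) (fun j => V j ω) ∂P = 0 := fun m => by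
    simp only [avg]
    rw [integral_const_mul, integral_const_mul,
      integral_finsetSum _ fun j _ => (hm j).integrable (by norm_num)]
    rw [Finset.sum_congr rfl fun j _ => (hV.ident j).integral_eq]
    simp [h0]
  have hvar : ∀ m, Var[fun ω => a m * avg (s m) fun j => V j ω; P]
      = a m ^ 2 * (s m : ℝ)⁻¹ * Var[V 0; P] := fun m => by
    rw [variance_const_mul, hV.variance_avg hint, mul_assoc]
  have hlim : Tendsto (fun m => ENNReal.ofReal (a m ^ 2 * (s m : ℝ)⁻¹ * Var[V 0; P] / ε ^ 2))
      atTop (𝓝 0) := by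
    rw [← ENNReal.ofReal_zero]
    refine ENNReal.tendsto_ofReal ?_
    simpa using (ha.mul_const Var[V 0; P]).div_const (ε ^ 2)
  refine tendsto_of_tendsto_of_tendsto_of_le_of_le tendsto_const_nhds hlim (fun _ => zero_le)
    fun m => ?_
  have := meas_ge_le_variance_div_sq (hmem m) hε
  rw [hvar, hmean] at this
  simpa [Real.norm_eq_abs] using this

end ConvergenceInProbability

/-! ### Matrix inverses, Moore--Penrose inverses and rank factorizations -/

/-- The Moore--Penrose inverse is discontinuous but Borel measurable: its graph is closed by the
Penrose equations, and a map between Polish spaces with Borel graph is measurable by the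
Lusin--Souslin theorem. -/
theorem measurable_pinv_apply {Ω : Type*} [MeasurableSpace Ω] {p q : ℕ}
    {A : Ω → Matrix (Fin p) (Fin q) ℝ} (hA : ∀ i j, Measurable fun ω => A ω i j)
    (i : Fin q) (j : Fin p) : Measurable fun ω => pinv (A ω) i j := by
  let g : (Fin p → Fin q → ℝ) → Fin q → Fin p → ℝ := fun B => pinv (Matrix.of B)
  suffices hg : Measurable g by
    have hA' : Measurable fun ω => (fun i j => A ω i j : Fin p → Fin q → ℝ) :=
      measurable_pi_lambda _ fun i => measurable_pi_lambda _ fun j => hA i j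
    exact (measurable_pi_apply j).comp ((measurable_pi_apply i).comp (hg.comp hA'))
  intro S hS
  let Γ : Set ((Fin p → Fin q → ℝ) × (Fin q → Fin p → ℝ)) :=
    {z | IsMoorePenrose (Matrix.of z.1) (Matrix.of z.2)}
  have hΓ : IsClosed Γ := by
    have : Γ = {z | Matrix.of z.1 * Matrix.of z.2 * Matrix.of z.1 = Matrix.of z.1} ∩
        {z | Matrix.of z.2 * Matrix.of z.1 * Matrix.of z.2 = Matrix.of z.2} ∩
        {z | (Matrix.of z.1 * Matrix.of z.2)ᵀ = Matrix.of z.1 * Matrix.of z.2} ∩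
        {z | (Matrix.of z.2 * Matrix.of z.1)ᵀ = Matrix.of z.2 * Matrix.of z.1} := by
      ext z
      exact ⟨fun h => ⟨⟨⟨h.1, h.2⟩, h.3⟩, h.4⟩, fun h => ⟨h.1.1.1, h.1.1.2, h.1.2, h.2⟩⟩
    have h1 : Continuous fun z : (Fin p → Fin q → ℝ) × (Fin q → Fin p → ℝ) => Matrix.of z.1 :=
      continuous_fst
    have h2 : Continuous fun z : (Fin p → Fin q → ℝ) × (Fin q → Fin p → ℝ) => Matrix.of z.2 :=
      continuous_snd
    rw [this]
    refine ((IsClosed.inter ?_ ?_).inter ?_).inter ?_ <;>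
      exact isClosed_eq (by fun_prop) (by fun_prop)
  have himage : g ⁻¹' S = Prod.fst '' (Γ ∩ Prod.snd ⁻¹' S) := by
    ext A
    constructor
    · intro hA
      exact ⟨(A, g A), ⟨pinv_spec (Matrix.of A), hA⟩, rfl⟩
    · rintro ⟨⟨A', X⟩, ⟨hX, hXS⟩, rfl⟩
      have : g A' = X := (pinv_spec (Matrix.of A')).unique hX
      simpa [this] using hXS
  rw [himage]
  refine (hΓ.measurableSet.inter (measurable_snd hS)).image_of_continuousOn_injOn
    continuous_fst.continuousOn ?_
  rintro ⟨A, X⟩ ⟨hX, -⟩ ⟨A', X'⟩ ⟨hX', -⟩ rfl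
  exact Prod.ext rfl (IsMoorePenrose.unique hX hX')

theorem measurable_nonsing_inv_apply {Ω : Type*} [MeasurableSpace Ω] {p : ℕ}
    {A : Ω → Matrix (Fin p) (Fin p) ℝ} (hA : ∀ i j, Measurable fun ω => A ω i j)
    (i j : Fin p) : Measurable fun ω => (A ω)⁻¹ i j := by
  have hA' : Measurable fun ω => (fun i j => A ω i j : Fin p → Fin p → ℝ) :=
    measurable_pi_lambda _ fun i => measurable_pi_lambda _ fun j => hA i j
  have hof : Continuous fun B : Fin p → Fin p → ℝ => Matrix.of B := continuous_id
  have hdet : Continuous fun B : Fin p → Fin p → ℝ => (Matrix.of B).det := hof.matrix_det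
  have hadj : Continuous fun B : Fin p → Fin p → ℝ => (Matrix.of B).adjugate i j :=
    hof.matrix_adjugate.matrix_elem i j
  have h := (hdet.measurable.comp hA').inv.mul (hadj.measurable.comp hA')
  convert h using 1
  funext ω
  rw [Matrix.inv_def, Ring.inverse_eq_inv']
  rfl

theorem tendsto_nonsing_inv {α : Type*} {l : Filter α} {p : ℕ} {A : α → Matrix (Fin p) (Fin p) ℝ}
    {B : Matrix (Fin p) (Fin p) ℝ} (hA : Tendsto A l (𝓝 B)) (hB : IsUnit B) :
    Tendsto (fun z => (A z)⁻¹) l (𝓝 B⁻¹) := by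
  have hdet := ((continuous_id.matrix_det).tendsto B).comp hA
  have hadj := ((continuous_id.matrix_adjugate).tendsto B).comp hA
  have hne : B.det ≠ 0 := ((Matrix.isUnit_iff_isUnit_det B).1 hB).ne_zero
  simp only [Matrix.inv_def, Ring.inverse_eq_inv']
  exact (hdet.inv₀ hne).smul hadj

theorem eventually_isUnit {α : Type*} {l : Filter α} {p : ℕ} {A : α → Matrix (Fin p) (Fin p) ℝ}
    {B : Matrix (Fin p) (Fin p) ℝ} (hA : Tendsto A l (𝓝 B)) (hB : IsUnit B) :
    ∀ᶠ z in l, IsUnit (A z) := by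
  have hdet := ((continuous_id.matrix_det).tendsto B).comp hA
  have hne : B.det ≠ 0 := ((Matrix.isUnit_iff_isUnit_det B).1 hB).ne_zero
  filter_upwards [hdet.eventually_ne hne] with z hz
  rw [Matrix.isUnit_iff_isUnit_det, isUnit_iff_ne_zero]
  exact hz

/-- If `N` has a left inverse, the possibly singular matrix `N G Nᵀ` enters the Wald statistic only
through the inverse of `G`. -/
theorem transpose_mul_pinv_mul_self {p r : ℕ} {N : Matrix (Fin r) (Fin p) ℝ}
    {L : Matrix (Fin p) (Fin r) ℝ} (hL : L * N = 1) {G : Matrix (Fin p) (Fin p) ℝ}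
    (hG : IsUnit G) : Nᵀ * pinv (N * G * Nᵀ) * N = G⁻¹ := by
  have hdet := (Matrix.isUnit_iff_isUnit_det G).1 hG
  have hLt : Nᵀ * Lᵀ = 1 := by rw [← transpose_mul, hL, transpose_one]
  have h := (pinv_spec (N * G * Nᵀ)).mul_inv_mul
  set X := pinv (N * G * Nᵀ)
  calc Nᵀ * X * N = (G⁻¹ * G) * (Nᵀ * X * N) * (G * G⁻¹) := by
        rw [Matrix.nonsing_inv_mul _ hdet, Matrix.mul_nonsing_inv _ hdet]; simp
    _ = G⁻¹ * ((L * N) * G * (Nᵀ * X * N) * G * (Nᵀ * Lᵀ)) * G⁻¹ := by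
        rw [hL, hLt]; simp [Matrix.mul_assoc]
    _ = G⁻¹ * (L * (N * G * Nᵀ * X * (N * G * Nᵀ)) * Lᵀ) * G⁻¹ := by
        simp only [Matrix.mul_assoc]
    _ = G⁻¹ * ((L * N) * G * (Nᵀ * Lᵀ)) * G⁻¹ := by
        rw [h]; simp only [Matrix.mul_assoc]
    _ = G⁻¹ := by
        rw [hL, hLt]; simp [Matrix.nonsing_inv_mul _ hdet]

theorem isUnit_of_rank_eq {p : ℕ} {A : Matrix (Fin p) (Fin p) ℝ} (h : A.rank = p) : IsUnit A := by
  rw [← Matrix.linearIndependent_rows_iff_isUnit, linearIndependent_iff_card_eq_finrank_span,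
    Set.finrank, ← Matrix.rank_eq_finrank_span_row, h, Fintype.card_fin]

/-- A rank factorization `A = N Uᵀ` with orthonormal columns of `U` and injective `N`: the columns of
`U` are an orthonormal basis of the row space. -/
theorem exists_rank_factorization {r k p : ℕ} (A : Matrix (Fin r) (Fin k) ℝ) (hA : A.rank = p) :
    ∃ (U : Matrix (Fin k) (Fin p) ℝ) (N : Matrix (Fin r) (Fin p) ℝ)
      (L : Matrix (Fin p) (Fin r) ℝ), A = N * Uᵀ ∧ Uᵀ * U = 1 ∧ L * N = 1 := by
  let e := (WithLp.linearEquiv 2 ℝ (Fin k → ℝ)).symm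
  let V : Submodule ℝ (EuclideanSpace ℝ (Fin k)) :=
    (Submodule.span ℝ (Set.range A.row)).map e.toLinearMap
  have hrank : Module.finrank ℝ V = p := by
    rw [← hA, A.rank_eq_finrank_span_row]
    exact LinearEquiv.finrank_map_eq e _
  let b : OrthonormalBasis (Fin p) ℝ V := (stdOrthonormalBasis ℝ V).reindex (finCongr hrank)
  let U : Matrix (Fin k) (Fin p) ℝ := Matrix.of fun i j => (b j : EuclideanSpace ℝ (Fin k)) i
  have hrow : ∀ i, e (A.row i) ∈ V := fun i =>
    Submodule.mem_map_of_mem (Submodule.subset_span ⟨i, rfl⟩)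
  have hU : Uᵀ * U = 1 := by
    ext i j
    have h := orthonormal_iff_ite.1 b.orthonormal i j
    rw [Submodule.coe_inner, PiLp.inner_apply] at h
    rw [Matrix.one_apply, ← h, Matrix.mul_apply]
    refine Finset.sum_congr rfl fun l _ => ?_
    exact mul_comm _ _
  obtain ⟨N, hN⟩ : ∃ N : Matrix (Fin r) (Fin p) ℝ, A = N * Uᵀ := by
    refine ⟨Matrix.of fun i j => b.repr ⟨_, hrow i⟩ j, ?_⟩
    ext i l
    have h := congrArg (fun v : V => (v : EuclideanSpace ℝ (Fin k)) l) (b.sum_repr ⟨_, hrow i⟩)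
    simp only [Submodule.coe_sum, Submodule.coe_smul, WithLp.ofLp_sum, Finset.sum_apply,
      WithLp.ofLp_smul, Pi.smul_apply, smul_eq_mul] at h
    exact h.symm
  have hNrank : (Nᵀ * N).rank = p := by
    refine le_antisymm ((Matrix.rank_le_width _)) ?_
    rw [Matrix.rank_transpose_mul_self]
    calc p = (N * Uᵀ).rank := by rw [← hN, hA]
      _ ≤ N.rank := Matrix.rank_mul_le_left _ _
  have hunit := (Matrix.isUnit_iff_isUnit_det _).1 (isUnit_of_rank_eq hNrank)
  refine ⟨U, N, (Nᵀ * N)⁻¹ * Nᵀ, hN, hU, ?_⟩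
  rw [Matrix.mul_assoc, Matrix.nonsing_inv_mul _ hunit]

/-! ### Orthogonal projections of a standard normal vector -/

/-- If `U` has orthonormal columns, `Uᵀ` maps a standard normal vector to a standard normal
vector. -/
theorem map_orthonormal_pi_gaussianReal {k p : ℕ} {U : Matrix (Fin k) (Fin p) ℝ}
    (hU : Uᵀ * U = 1) :
    (Measure.pi fun _ : Fin k => gaussianReal 0 1).map (fun z => Uᵀ *ᵥ z)
      = Measure.pi fun _ : Fin p => gaussianReal 0 1 := by
  have hmeas : Measurable fun z : Fin k → ℝ => Uᵀ *ᵥ z := by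
    have : Continuous fun z : Fin k → ℝ => Uᵀ *ᵥ z := by fun_prop
    exact this.measurable
  have hinv : ∀ ν : Measure (Fin p → ℝ), (ν.map (WithLp.toLp 2)).map WithLp.ofLp = ν := fun ν => by
    rw [Measure.map_map (by fun_prop) (by fun_prop)]
    exact Measure.map_id
  rw [← hinv (Measure.map _ _), ← hinv (Measure.pi _)]
  congr 1
  refine Measure.ext_of_charFun (E := EuclideanSpace ℝ (Fin p)) ?_
  ext t
  have h1 : charFun (((Measure.pi fun _ : Fin k => gaussianReal 0 1).map
      (fun z => Uᵀ *ᵥ z)).map (WithLp.toLp 2)) t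
      = charFun ((Measure.pi fun _ : Fin k => gaussianReal 0 1).map (WithLp.toLp 2))
        (WithLp.toLp 2 (U *ᵥ t.ofLp)) := by
    rw [Measure.map_map (by fun_prop) hmeas, charFun_apply, charFun_apply,
      integral_map ((by fun_prop : Measurable (WithLp.toLp 2 : (Fin p → ℝ) → _)).comp
        hmeas).aemeasurable (by fun_prop), integral_map (by fun_prop) (by fun_prop)]
    congr 1
    funext z
    congr 3
    rw [Function.comp_apply, EuclideanSpace.inner_toLp_toLp]
    change t.ofLp ⬝ᵥ (Uᵀ *ᵥ z) = (U *ᵥ t.ofLp) ⬝ᵥ z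
    rw [Matrix.dotProduct_mulVec, Matrix.vecMul_transpose]
  have h2 : ‖WithLp.toLp 2 (U *ᵥ t.ofLp)‖ ^ 2 = ‖t‖ ^ 2 := by
    rw [← real_inner_self_eq_norm_sq, ← real_inner_self_eq_norm_sq]
    change (U *ᵥ t.ofLp) ⬝ᵥ (U *ᵥ t.ofLp) = t.ofLp ⬝ᵥ t.ofLp
    rw [Matrix.dotProduct_mulVec, ← Matrix.mulVec_transpose, Matrix.mulVec_mulVec, hU,
      Matrix.one_mulVec]
  rw [h1, map_pi_eq_stdGaussian, map_pi_eq_stdGaussian, charFun_stdGaussian, charFun_stdGaussian]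
  norm_cast
  rw [h2]

theorem map_sum_sq_orthonormal {k p : ℕ} {U : Matrix (Fin k) (Fin p) ℝ} (hU : Uᵀ * U = 1) :
    (Measure.pi fun _ : Fin k => gaussianReal 0 1).map
      (fun z => (Uᵀ *ᵥ z) ⬝ᵥ (Uᵀ *ᵥ z)) = chiSquare p := by
  have hmeas : Measurable fun z : Fin k → ℝ => Uᵀ *ᵥ z := by
    have : Continuous fun z : Fin k → ℝ => Uᵀ *ᵥ z := by fun_prop
    exact this.measurable
  rw [chiSquare, ← map_orthonormal_pi_gaussianReal hU, Measure.map_map (by fun_prop) hmeas]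
  congr 1
  funext z
  simp [dotProduct, sq]

/-! ### The limit law of Wald-type statistics -/

section Wald

variable {Ω : Type*} [MeasurableSpace Ω] {P : Measure Ω} [IsProbabilityMeasure P]

/-- For independent coordinates, convergence in distribution of each coordinate gives joint
convergence to the product law. -/
theorem tendstoInDistribution_pi {k : ℕ} {G : Fin k → ℕ → Ω → ℝ}
    (hG : ∀ i m, Measurable (G i m)) (hind : ∀ m, iIndepFun (fun i => G i m) P)
    (hlim : ∀ i, TendstoInDistribution (G i) atTop (id : ℝ → ℝ) (fun _ => P) (gaussianReal 0 1)) :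
    TendstoInDistribution (fun m ω i => G i m ω) atTop (id : (Fin k → ℝ) → Fin k → ℝ)
      (fun _ => P) (Measure.pi fun _ => gaussianReal 0 1) where
  forall_aemeasurable m := (measurable_pi_lambda _ fun i => hG i m).aemeasurable
  aemeasurable_limit := aemeasurable_id
  tendsto := by
    -- forming finite products of probability measures is weakly continuous
    have h := (ProbabilityMeasure.continuous_pi (α := fun _ : Fin k => ℝ)).tendsto
      (fun i => ⟨(gaussianReal 0 1).map id, Measure.isProbabilityMeasure_map aemeasurable_id⟩)
    have h2 := h.comp (tendsto_pi_nhds.2 fun i => (hlim i).tendsto)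
    refine (h2.congr fun m => ?_).trans (le_of_eq ?_)
    · apply Subtype.ext
      exact ((iIndepFun_iff_map_fun_eq_pi_map fun i => (hG i m).aemeasurable).1 (hind m)).symm
    · congr 1
      apply Subtype.ext
      simp [ProbabilityMeasure.pi, Measure.map_id]

/-- Under the hypothesis `M θ = 0` the Wald statistic is an ordinary quadratic form in
`√N (v - θ)`, with the Moore--Penrose inverse replaced by an inverse. -/
theorem wald_eq {r k p : ℕ} (N : ℕ) {M : Matrix (Fin r) (Fin k) ℝ} {A : Matrix (Fin r) (Fin p) ℝ}
    {L : Matrix (Fin p) (Fin r) ℝ} {W : Matrix (Fin k) (Fin p) ℝ} (hM : M = A * Wᵀ)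
    (hL : L * A = 1) {S : Matrix (Fin k) (Fin k) ℝ} (hS : IsUnit (Wᵀ * S * W)) {θ : Fin k → ℝ}
    (hθ : M *ᵥ θ = 0) (v : Fin k → ℝ) :
    wald N M S v = (Wᵀ *ᵥ (√N • (v - θ))) ⬝ᵥ ((Wᵀ * S * W)⁻¹ *ᵥ (Wᵀ *ᵥ (√N • (v - θ)))) := by
  have h1 : M *ᵥ v = A *ᵥ (Wᵀ *ᵥ (v - θ)) := by
    rw [Matrix.mulVec_mulVec, ← hM, Matrix.mulVec_sub, hθ, sub_zero]
  have h2 : M * S * Mᵀ = A * (Wᵀ * S * W) * Aᵀ := by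
    rw [hM, transpose_mul, transpose_transpose]; simp only [Matrix.mul_assoc]
  set δ := Wᵀ *ᵥ (v - θ) with hδ
  have h3 : (N : ℝ) = √N * √N := (Real.mul_self_sqrt (Nat.cast_nonneg N)).symm
  rw [wald, h1, h2, Matrix.mulVec_smul, ← hδ, ← transpose_mul_pinv_mul_self hL hS,
    Matrix.mulVec_smul, smul_dotProduct, dotProduct_smul, smul_eq_mul, smul_eq_mul, ← mul_assoc,
    ← h3, ← Matrix.mulVec_mulVec, ← Matrix.mulVec_mulVec, Matrix.dotProduct_mulVec _ Aᵀ,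
    Matrix.vecMul_transpose]

theorem measurable_wald {r k : ℕ} (N : ℕ) (M : Matrix (Fin r) (Fin k) ℝ) {S v : Ω → Fin k → ℝ}
    (hS : ∀ i, Measurable fun ω => S ω i) (hv : ∀ i, Measurable fun ω => v ω i) :
    Measurable fun ω => wald N M (diagonal (S ω)) (v ω) := by
  have hMS : ∀ i j, Measurable fun ω => (M * diagonal (S ω) * Mᵀ) i j := fun i j => by
    simp_rw [Matrix.mul_apply (N := Mᵀ), Matrix.mul_diagonal]
    exact Finset.measurable_sum _ fun l _ => ((hS l).const_mul _).mul_const _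
  have hMv : ∀ i, Measurable fun ω => (M *ᵥ v ω) i := fun i => by
    simp only [Matrix.mulVec, dotProduct]
    exact Finset.measurable_sum _ fun l _ => (hv l).const_mul _
  have hp := measurable_pinv_apply hMS
  unfold wald
  refine Measurable.const_mul ?_ _
  refine Finset.measurable_sum _ fun i _ => (hMv i).mul ?_
  simp only [Matrix.mulVec, dotProduct] at hMv ⊢
  exact Finset.measurable_sum _ fun j _ => (hp i j).mul (hMv j)

/-- Limit law of the Wald statistic. If `√N (vᵢ - θᵢ) = Jᵢ Gᵢ + o_P(1)` with independent `Gᵢ`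
converging to standard normal variables and `Jᵢ → Kᵢ ≠ 0` in probability, and if `Kᵢ²` is estimated
consistently by `Sᵢ`, then the statistic converges under `M θ = 0` to `χ²` with `rank M` degrees of
freedom. With `D = diag K` and `M D = A Uᵀ` a rank factorization, put `W = D⁻¹ U`, so that `M = A Wᵀ`.
The statistic is then a quadratic form in `Wᵀ √N (v - θ)` with matrix `(Wᵀ S W)⁻¹ → 1`, and
`Wᵀ D = Uᵀ` maps the limit of `G` to a standard normal vector. -/
theorem tendstoInDistribution_wald {r k : ℕ} (M : Matrix (Fin r) (Fin k) ℝ) {N : ℕ → ℕ}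
    {v S : ℕ → Ω → Fin k → ℝ} (hv : ∀ m i, Measurable fun ω => v m ω i)
    (hS : ∀ m i, Measurable fun ω => S m ω i)
    {θ K : Fin k → ℝ} (hK : ∀ i, K i ≠ 0) (hθ : M *ᵥ θ = 0)
    (hSlim : ∀ i, Tendsto (fun z : ℕ × Ω => S z.1 z.2 i) (probFilter P) (𝓝 (K i ^ 2)))
    {G : Fin k → ℕ → Ω → ℝ} (hG : ∀ i m, Measurable (G i m))
    (hind : ∀ m, iIndepFun (fun i => G i m) P)
    (hlim : ∀ i, TendstoInDistribution (G i) atTop (id : ℝ → ℝ) (fun _ => P) (gaussianReal 0 1))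
    {J : Fin k → ℕ → Ω → ℝ} (hJ : ∀ i m, Measurable (J i m))
    (hJlim : ∀ i, Tendsto (fun z : ℕ × Ω => J i z.1 z.2) (probFilter P) (𝓝 (K i)))
    (hexp : ∀ i, Tendsto (fun z : ℕ × Ω => √(N z.1) * (v z.1 z.2 i - θ i)
      - J i z.1 z.2 * G i z.1 z.2) (probFilter P) (𝓝 0)) :
    TendstoInDistribution (fun m ω => wald (N m) M (diagonal (S m ω)) (v m ω)) atTop
      (id : ℝ → ℝ) (fun _ => P) (chiSquare M.rank) := by
  set D : Matrix (Fin k) (Fin k) ℝ := diagonal K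
  have hDdet : IsUnit D.det := by
    rw [Matrix.det_diagonal, isUnit_iff_ne_zero]
    exact Finset.prod_ne_zero_iff.2 fun i _ => hK i
  obtain ⟨U, A, L, hA, hU, hL⟩ := exists_rank_factorization (M * D) (p := M.rank)
    (Matrix.rank_mul_eq_left_of_isUnit_det _ _ hDdet)
  set W : Matrix (Fin k) (Fin M.rank) ℝ := D⁻¹ * U with hW
  have hDt : Dᵀ = D := diagonal_transpose _
  have hDit : (D⁻¹)ᵀ = D⁻¹ := by rw [Matrix.transpose_nonsing_inv, hDt]
  have hMW : M = A * Wᵀ := by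
    rw [hW, transpose_mul, hDit, ← Matrix.mul_assoc, ← hA, Matrix.mul_assoc,
      Matrix.mul_nonsing_inv _ hDdet, Matrix.mul_one]
  have hWD : Wᵀ * D = Uᵀ := by
    rw [hW, transpose_mul, hDit, Matrix.mul_assoc, Matrix.nonsing_inv_mul _ hDdet, Matrix.mul_one]
  have hDW : D * W = U := by
    rw [hW, ← Matrix.mul_assoc, Matrix.mul_nonsing_inv _ hDdet, Matrix.one_mul]
  -- the matrices `Wᵀ S W` converge to the identity
  have hSvec : Tendsto (fun z : ℕ × Ω => S z.1 z.2) (probFilter P) (𝓝 fun i => K i ^ 2) :=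
    tendsto_pi_nhds.2 hSlim
  have hmid : Tendsto (fun z : ℕ × Ω => Wᵀ * diagonal (S z.1 z.2) * W) (probFilter P) (𝓝 1) := by
    have hc : Continuous fun s : Fin k → ℝ => Wᵀ * diagonal s * W := by fun_prop
    have h := (hc.tendsto _).comp hSvec
    have h1 : Wᵀ * diagonal (fun i => K i ^ 2) * W = 1 := by
      have : diagonal (fun i => K i ^ 2) = D * D := by
        rw [diagonal_mul_diagonal]; simp only [sq]
      rw [this, ← Matrix.mul_assoc Wᵀ, hWD, Matrix.mul_assoc, hDW, hU]
    rwa [h1] at h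
  have hunit := eventually_isUnit hmid isUnit_one
  have hinv := tendsto_nonsing_inv hmid isUnit_one
  rw [inv_one] at hinv
  -- Slutsky's theorem needs a function continuous everywhere, so the inverse matrix, which is
  -- continuous only near its limit, is one of the arguments.
  let Y : ℕ → Ω → (Fin k → ℝ) × (Fin k → ℝ) × (Fin M.rank → Fin M.rank → ℝ) := fun m ω =>
    (fun i => J i m ω, fun i => √(N m) * (v m ω i - θ i) - J i m ω * G i m ω,
      fun a b => (Wᵀ * diagonal (S m ω) * W)⁻¹ a b)
  let f : (Fin k → ℝ) × ((Fin k → ℝ) × (Fin k → ℝ) × (Fin M.rank → Fin M.rank → ℝ)) → ℝ :=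
    fun x => (Wᵀ *ᵥ (fun i => x.2.1 i * x.1 i + x.2.2.1 i)) ⬝ᵥ
      (Matrix.of x.2.2.2 *ᵥ (Wᵀ *ᵥ (fun i => x.2.1 i * x.1 i + x.2.2.1 i)))
  have hf : Continuous f := by
    have h1 : Continuous fun x : (Fin k → ℝ) × ((Fin k → ℝ) × (Fin k → ℝ) ×
        (Fin M.rank → Fin M.rank → ℝ)) => (fun i => x.2.1 i * x.1 i + x.2.2.1 i : Fin k → ℝ) := by
      fun_prop
    have h2 : Continuous fun x : (Fin k → ℝ) × ((Fin k → ℝ) × (Fin k → ℝ) ×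
        (Fin M.rank → Fin M.rank → ℝ)) => Matrix.of x.2.2.2 :=
      continuous_snd.comp (continuous_snd.comp continuous_snd)
    fun_prop
  have hYm : ∀ m, Measurable (Y m) := by
    intro m
    refine (measurable_pi_lambda _ fun i => hJ i m).prodMk ((measurable_pi_lambda _ fun i =>
      (((hv m i).sub_const _).const_mul _).sub ((hJ i m).mul (hG i m))).prodMk
      (measurable_pi_lambda _ fun a => measurable_pi_lambda _ fun b =>
        measurable_nonsing_inv_apply (fun a b => ?_) a b))
    simp_rw [Matrix.mul_apply (N := W), Matrix.mul_diagonal]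
    exact Finset.measurable_sum _ fun l _ => ((hS m l).const_mul _).mul_const _
  have hYlim : TendstoInMeasure P Y atTop fun _ => (K, 0, fun a b => (1 : Matrix _ _ ℝ) a b) := by
    rw [tendstoInMeasure_iff_tendsto_probFilter]
    exact (tendsto_pi_nhds.2 hJlim).prodMk_nhds ((tendsto_pi_nhds.2 hexp).prodMk_nhds
      (tendsto_pi_nhds.2 fun a => tendsto_pi_nhds.2 fun b =>
        ((continuous_id.matrix_elem a b).tendsto (1 : Matrix _ _ ℝ)).comp hinv))
  have hslut := (tendstoInDistribution_pi hG hind hlim).continuous_comp_prodMk_of_tendstoInMeasure_const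
    hf hYlim fun m => (hYm m).aemeasurable
  have hwm : ∀ m, Measurable fun ω => wald (N m) M (diagonal (S m ω)) (v m ω) := fun m =>
    measurable_wald _ _ (hS m) (hv m)
  have hdiff : TendstoInMeasure P ((fun m ω => wald (N m) M (diagonal (S m ω)) (v m ω))
      - fun m ω => f (fun i => G i m ω, Y m ω)) atTop 0 := by
    refine tendstoInMeasure_iff_tendsto_probFilter.2 (tendsto_const_nhds.congr' ?_)
    filter_upwards [hunit] with z hz
    refine (sub_eq_zero.2 ?_).symm
    simp only
    rw [wald_eq (N z.1) hMW hL hz hθ]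
    have : √(N z.1) • (v z.1 z.2 - θ) = fun i => J i z.1 z.2 * G i z.1 z.2 +
        (√(N z.1) * (v z.1 z.2 i - θ i) - J i z.1 z.2 * G i z.1 z.2) := by
      funext i; simp
    rw [this]
    rfl
  have hfin := tendstoInDistribution_of_tendstoInMeasure_sub _ _ hslut hdiff
    fun m => (hwm m).aemeasurable
  refine ⟨hfin.forall_aemeasurable, aemeasurable_id, ?_⟩
  refine hfin.tendsto.trans (le_of_eq ?_)
  congr 1
  apply Subtype.ext
  change Measure.map _ _ = Measure.map id _
  rw [Measure.map_id, ← map_sum_sq_orthonormal hU]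
  refine congrArg (fun g => Measure.map g _) ?_
  funext z
  have hz : Wᵀ *ᵥ (fun i => K i * z i) = Uᵀ *ᵥ z := by
    rw [← hWD, ← Matrix.mulVec_mulVec]
    congr 1
    funext i
    simp [D, Matrix.mulVec_diagonal]
  simp only [f, id, Pi.zero_apply, add_zero]
  rw [hz]
  change _ ⬝ᵥ ((1 : Matrix _ _ ℝ) *ᵥ _) = _
  rw [Matrix.one_mulVec]

end Wald

/-! ### Independence of groups, and conditionally two-point distributions -/

section Population

variable {Ω : Type*} [MeasurableSpace Ω] {P : Measure Ω} [IsProbabilityMeasure P]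

/-- Groups of independent variables are independent as random sequences. -/
theorem iIndepFun_curry {ι κ E : Type*} [MeasurableSpace E] {X : ι → κ → Ω → E}
    (hmeas : ∀ i j, Measurable (X i j)) (hX : iIndepFun (fun ij : ι × κ => X ij.1 ij.2) P) :
    iIndepFun (fun i ω j => X i j ω) P := by
  have hpr : ∀ i j, IsProbabilityMeasure (P.map (X i j)) := fun i j =>
    Measure.isProbabilityMeasure_map (hmeas i j).aemeasurable
  have hm : ∀ i, Measurable fun ω j => X i j ω := fun i => measurable_pi_lambda _ (hmeas i)
  have hmm : Measurable fun ω (ij : ι × κ) => X ij.1 ij.2 ω :=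
    measurable_pi_lambda _ fun ij => hmeas ij.1 ij.2
  have h := hX.map_fun_eq_infinitePi_map fun ij : ι × κ => hmeas ij.1 ij.2
  have hc := congrArg (Measure.map (MeasurableEquiv.curry ι κ E)) h
  rw [Measure.infinitePi_map_curry (fun i j => P.map (X i j)),
    Measure.map_map (by fun_prop) hmm] at hc
  rw [iIndepFun_iff_map_fun_eq_infinitePi_map hm]
  refine hc.trans ?_
  congr 1
  funext i
  have hinj : Function.Injective fun j : κ => (i, j) := fun a b hab => congrArg Prod.snd hab
  exact ((hX.precomp hinj).map_fun_eq_infinitePi_map (hmeas i)).symm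

variable {d : ℕ} {Z : Ω → Fin d → ℝ}

/-- A coordinate that almost surely takes one of two values determined by the remaining coordinates
is conditionally two-point distributed. -/
theorem isCondTwoPoint_of_ae (hZ : Measurable Z) {s : Fin d}
    {a b : ({t : Fin d // t ≠ s} → ℝ) → ℝ} (ha : Measurable a) (hb : Measurable b)
    (h : ∀ᵐ ω ∂P, Z ω s = a (fun t => Z ω t) ∨ Z ω s = b (fun t => Z ω t)) :
    IsCondTwoPoint P Z s := by
  have hZs : Measurable fun ω => Z ω s := (measurable_pi_apply s).comp hZ
  have hR : Measurable fun ω (t : {t : Fin d // t ≠ s}) => Z ω t :=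
    measurable_pi_lambda _ fun t => (measurable_pi_apply _).comp hZ
  have hset : MeasurableSet {z : ({t : Fin d // t ≠ s} → ℝ) × ℝ | z.2 = a z.1 ∨ z.2 = b z.1} :=
    (measurableSet_eq_fun measurable_snd (ha.comp measurable_fst)).union
      (measurableSet_eq_fun measurable_snd (hb.comp measurable_fst))
  have h1 : ∀ᵐ z ∂(P.map fun ω => ((fun (t : {t : Fin d // t ≠ s}) => Z ω t), Z ω s)),
      z.2 = a z.1 ∨ z.2 = b z.1 := (ae_map_iff (hR.prodMk hZs).aemeasurable hset).2 h
  rw [← compProd_map_condDistrib hZs.aemeasurable] at h1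
  filter_upwards [Measure.ae_ae_of_ae_compProd h1] with y hy
  have hsub : (condDistrib (fun ω => Z ω s) (fun ω (t : {t : Fin d // t ≠ s}) => Z ω t) P
      y).support ⊆ {a y, b y} :=
    Measure.support_subset_of_isClosed (Set.toFinite _).isClosed hy
  refine (Set.encard_le_encard hsub).trans ((Set.encard_insert_le _ _).trans ?_)
  rw [Set.encard_singleton]
  norm_num

/-- If a nontrivial linear combination of the coordinates takes at most two values, solve for a
coordinate with nonzero coefficient. -/
theorem exists_isCondTwoPoint_of_ae_dotProduct (hZ : Measurable Z) {w : Fin d → ℝ} (hw : w ≠ 0)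
    {c₁ c₂ : ℝ} (h : ∀ᵐ ω ∂P, w ⬝ᵥ Z ω = c₁ ∨ w ⬝ᵥ Z ω = c₂) : ∃ s, IsCondTwoPoint P Z s := by
  obtain ⟨s, hs⟩ := Function.ne_iff.1 hw
  simp only [Pi.zero_apply] at hs
  refine ⟨s, isCondTwoPoint_of_ae hZ
    (a := fun y => (c₁ - ∑ t : {t : Fin d // t ≠ s}, w t * y t) / w s)
    (b := fun y => (c₂ - ∑ t : {t : Fin d // t ≠ s}, w t * y t) / w s)
    (by fun_prop) (by fun_prop) ?_⟩
  filter_upwards [h] with ω hω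
  simp only [eq_div_iff hs, eq_sub_iff_add_eq]
  rw [dotProduct, Fintype.sum_eq_add_sum_subtype_ne _ s] at hω
  simpa [mul_comm (Z ω s)] using hω

/-! ### Moments of quadratic features -/

theorem variance_dotProduct {ι : Type*} [Fintype ι] {f : ι → Ω → ℝ} (hf : ∀ i, MemLp (f i) 2 P)
    (c : ι → ℝ) : Var[fun ω => ∑ i, c i * f i ω; P]
      = c ⬝ᵥ ((Matrix.of fun i j => cov[f i, f j; P]) *ᵥ c) := by
  rw [variance_fun_sum fun i => (hf i).const_mul (c i)]
  simp only [covariance_const_mul_left, covariance_const_mul_right, dotProduct, Matrix.mulVec,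
    Matrix.of_apply, Finset.mul_sum]
  refine Finset.sum_congr rfl fun i _ => Finset.sum_congr rfl fun j _ => ?_
  ring

theorem memLp_two_mul {P : Measure Ω} {f g : Ω → ℝ} (hf : Measurable f) (hg : Measurable g)
    (hf4 : Integrable (fun ω => f ω ^ 4) P) (hg4 : Integrable (fun ω => g ω ^ 4) P) :
    MemLp (fun ω => f ω * g ω) 2 P := by
  refine (memLp_two_iff_integrable_sq (hf.mul hg).aestronglyMeasurable).2 ?_
  refine (hf4.add hg4).mono' ((hf.mul hg).pow_const 2).aestronglyMeasurable (ae_of_all _ fun ω => ?_)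
  rw [Real.norm_of_nonneg (by positivity)]
  change (f ω * g ω) ^ 2 ≤ f ω ^ 4 + g ω ^ 4
  nlinarith [sq_nonneg (f ω ^ 2 - g ω ^ 2), sq_nonneg (f ω ^ 2), sq_nonneg (g ω ^ 2)]

/-- The vector `(x, x ⊗ x)` of first and second order monomials. The block matrix in the variance
estimator is the empirical covariance matrix of these features. -/
def feature (x : Fin d → ℝ) : Fin d ⊕ (Fin d × Fin d) → ℝ :=
  Sum.elim x fun ab => x ab.1 * x ab.2

theorem measurable_feature (α : Fin d ⊕ (Fin d × Fin d)) :
    Measurable fun x : Fin d → ℝ => feature x α := by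
  rcases α with s | ab <;> simp only [feature, Sum.elim_inl, Sum.elim_inr] <;> fun_prop

theorem memLp_two_feature (hZ : Measurable Z) (hmom : ∀ s, Integrable (fun ω => Z ω s ^ 4) P)
    (α : Fin d ⊕ (Fin d × Fin d)) : MemLp (fun ω => feature (Z ω) α) 2 P := by
  have hs : ∀ s, Measurable fun ω => Z ω s := fun s => (measurable_pi_apply s).comp hZ
  rcases α with s | ab
  · simpa [feature] using
      memLp_two_mul (hs s) (measurable_const (a := (1 : ℝ))) (hmom s) (by simp)
  · exact memLp_two_mul (hs _) (hs _) (hmom _) (hmom _)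

/-- With `u = μᵀ Σ⁻¹`, the linear form `A(μ, Σ)` applied to `(x, x ⊗ x)` is a quadratic polynomial in
`u · x`; the matrix `D̃(μ)` contributes the cross term. -/
theorem Avec_dotProduct_feature (m : Fin d → ℝ) (S : Matrix (Fin d) (Fin d) ℝ) (x : Fin d → ℝ) :
    ∑ α, Avec m S α * feature x α = 2 * ((m ᵥ* S⁻¹) ⬝ᵥ x)
      + 2 * ((m ᵥ* S⁻¹) ⬝ᵥ m) * ((m ᵥ* S⁻¹) ⬝ᵥ x) - ((m ᵥ* S⁻¹) ⬝ᵥ x) ^ 2 := by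
  have hD : ∀ a b, ∑ s, Dtilde m (a, b) s * x s = -(m b * x a) - m a * x b := by
    intro a b
    by_cases hab : a = b
    · subst hab
      simp only [Dtilde, Matrix.of_apply, sub_mul, neg_mul, ite_mul, zero_mul,
        Finset.sum_sub_distrib, ne_eq, not_true_eq_false, and_false, if_false, and_true]
      have : ∀ s : Fin d, ¬ (a = s ∧ ¬ s = a) := fun s h => h.2 h.1.symm
      simp [this]; ring
    · have hba : ¬ b = a := fun h => hab h.symm
      have : ∀ s : Fin d, (b = s ∧ ¬ s = a) ↔ s = b := fun s =>
        ⟨fun h => h.1.symm, fun h => ⟨h.symm, h ▸ hba⟩⟩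
      simp [Dtilde, sub_mul, Finset.sum_sub_distrib, hab, hba, this]
  set u := m ᵥ* S⁻¹
  have h1 : ∑ s, (kronVec u u ᵥ* Dtilde m) s * x s = -2 * (u ⬝ᵥ m) * (u ⬝ᵥ x) := by
    have : ∑ s, (kronVec u u ᵥ* Dtilde m) s * x s
        = ∑ a, ∑ b, u a * u b * (-(m b * x a) - m a * x b) := by
      simp only [Matrix.vecMul, dotProduct, Finset.sum_mul, Fintype.sum_prod_type, kronVec]
      rw [Finset.sum_comm]
      refine Finset.sum_congr rfl fun a _ => ?_
      rw [Finset.sum_comm]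
      refine Finset.sum_congr rfl fun b _ => ?_
      rw [← hD, Finset.mul_sum]
      exact Finset.sum_congr rfl fun s _ => by ring
    have e1 : (u ⬝ᵥ x) * (u ⬝ᵥ m) = ∑ a, ∑ b, (u a * x a) * (u b * m b) :=
      Finset.sum_mul_sum _ _ _ _
    have e2 : (u ⬝ᵥ m) * (u ⬝ᵥ x) = ∑ a, ∑ b, (u a * m a) * (u b * x b) :=
      Finset.sum_mul_sum _ _ _ _
    have e3 : -2 * (u ⬝ᵥ m) * (u ⬝ᵥ x) = -((u ⬝ᵥ x) * (u ⬝ᵥ m)) - (u ⬝ᵥ m) * (u ⬝ᵥ x) := by ring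
    rw [this, e3, e1, e2, ← Finset.sum_neg_distrib, ← Finset.sum_sub_distrib]
    refine Finset.sum_congr rfl fun a _ => ?_
    rw [← Finset.sum_neg_distrib, ← Finset.sum_sub_distrib]
    exact Finset.sum_congr rfl fun b _ => by ring
  have h2 : ∑ ab : Fin d × Fin d, kronVec u u ab * (x ab.1 * x ab.2) = (u ⬝ᵥ x) ^ 2 := by
    rw [sq, Fintype.sum_prod_type]
    refine Eq.trans ?_ (Finset.sum_mul_sum _ _ _ _).symm
    exact Finset.sum_congr rfl fun a _ => Finset.sum_congr rfl fun b _ => by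
      simp only [kronVec]; ring
  have h3 : u ⬝ᵥ x = ∑ s, u s * x s := rfl
  have key : ∑ α, Avec m S α * feature x α = 2 * (∑ s, u s * x s)
      - ∑ s, (kronVec u u ᵥ* Dtilde m) s * x s
      - ∑ ab : Fin d × Fin d, kronVec u u ab * (x ab.1 * x ab.2) := by
    rw [Fintype.sum_sum_type]
    simp only [Avec, feature, Sum.elim_inl, Sum.elim_inr, Pi.sub_apply, Pi.smul_apply, smul_eq_mul,
      Pi.neg_apply, neg_mul, sub_mul, Finset.sum_sub_distrib, Finset.sum_neg_distrib, mul_assoc,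
      ← Finset.mul_sum]
    ring
  rw [key, h1, h2, ← h3]
  ring

/-- Exact expansion of `mᵀ S⁻¹ m`. At `w = S⁻¹ m` the remainder vanishes, so the choice
`w = Σ⁻¹ μ` yields a linearization whose error is quadratic in `m - S w`. -/
theorem quadForm_eq_add {S : Matrix (Fin d) (Fin d) ℝ} (hS : IsUnit S) (hsymm : Sᵀ = S)
    (m w : Fin d → ℝ) : quadForm m S = 2 * (w ⬝ᵥ m) - w ⬝ᵥ (S *ᵥ w)
      + (m - S *ᵥ w) ⬝ᵥ (S⁻¹ *ᵥ (m - S *ᵥ w)) := by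
  have hdet := (Matrix.isUnit_iff_isUnit_det S).1 hS
  have h1 : S⁻¹ *ᵥ (S *ᵥ w) = w := by
    rw [Matrix.mulVec_mulVec, Matrix.nonsing_inv_mul _ hdet, Matrix.one_mulVec]
  have h2 : (S *ᵥ w) ⬝ᵥ (S⁻¹ *ᵥ m) = w ⬝ᵥ m := by
    rw [← Matrix.vecMul_transpose, hsymm, ← Matrix.dotProduct_mulVec, Matrix.mulVec_mulVec,
      Matrix.mul_nonsing_inv _ hdet, Matrix.one_mulVec]
  have h3 : (S *ᵥ w) ⬝ᵥ w = w ⬝ᵥ (S *ᵥ w) := dotProduct_comm _ _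
  rw [Matrix.mulVec_sub, h1, dotProduct_sub, sub_dotProduct, sub_dotProduct, h2, h3, quadForm,
    dotProduct_comm m w]
  ring

/-! ### The influence function of the quadratic form -/

/-- The influence function of `μᵀ Σ⁻¹ μ` at `x`, where `w = Σ⁻¹ μ` and `q = μᵀ Σ⁻¹ μ`. -/
def influence (w : Fin d → ℝ) (q : ℝ) (x : Fin d → ℝ) : ℝ :=
  2 * (w ⬝ᵥ x - q) - (w ⬝ᵥ x - q) ^ 2 + q

theorem quadForm_eq_dotProduct (m : Fin d → ℝ) (S : Matrix (Fin d) (Fin d) ℝ) :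
    quadForm m S = (m ᵥ* S⁻¹) ⬝ᵥ m := Matrix.dotProduct_mulVec _ _ _

theorem popCov_transpose {P : Measure Ω} : (popCov P Z)ᵀ = popCov P Z := by
  ext r s
  exact covariance_comm _ _

theorem mulVec_vecMul_inv {S : Matrix (Fin d) (Fin d) ℝ} (hS : IsUnit S) (hsymm : Sᵀ = S)
    (m : Fin d → ℝ) : S *ᵥ (m ᵥ* S⁻¹) = m := by
  have hdet := (Matrix.isUnit_iff_isUnit_det S).1 hS
  rw [← Matrix.mulVec_transpose, Matrix.transpose_nonsing_inv, hsymm, Matrix.mulVec_mulVec,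
    Matrix.mul_nonsing_inv _ hdet, Matrix.one_mulVec]

theorem memLp_two_coord (hZ : Measurable Z) (hmom : ∀ s, Integrable (fun ω => Z ω s ^ 4) P)
    (s : Fin d) : MemLp (fun ω => Z ω s) 2 P := memLp_two_feature hZ hmom (Sum.inl s)

theorem integrable_dotProduct_pow_four (hZ : Measurable Z)
    (hmom : ∀ s, Integrable (fun ω => Z ω s ^ 4) P) (w : Fin d → ℝ) (c : ℝ) :
    Integrable (fun ω => (w ⬝ᵥ Z ω - c) ^ 4) P := by
  have hs : ∀ s, Measurable fun ω => Z ω s := fun s => (measurable_pi_apply s).comp hZ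
  have h4 : ∀ s, MemLp (fun ω => Z ω s) 4 P := fun s => by
    refine (integrable_norm_rpow_iff (hs s).aestronglyMeasurable (by norm_num) (by norm_num)).1 ?_
    refine (hmom s).congr (ae_of_all _ fun ω => ?_)
    simp only [ENNReal.toReal_ofNat]
    norm_cast
    rw [Real.norm_eq_abs, Even.pow_abs (by decide)]
  have h := (memLp_finsetSum Finset.univ fun s _ => (h4 s).const_mul (w s)).sub (memLp_const c)
  have h' := h.integrable_norm_rpow (by norm_num) (by norm_num)
  refine h'.congr (ae_of_all _ fun ω => ?_)
  simp only [ENNReal.toReal_ofNat]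
  norm_cast
  rw [Real.norm_eq_abs, Even.pow_abs (by decide)]
  simp [dotProduct]

theorem integral_dotProduct (hZ : Measurable Z) (hmom : ∀ s, Integrable (fun ω => Z ω s ^ 4) P)
    (w : Fin d → ℝ) : ∫ ω, w ⬝ᵥ Z ω ∂P = w ⬝ᵥ popMean P Z := by
  simp only [dotProduct]
  rw [integral_finsetSum _ fun s _ =>
    ((memLp_two_coord hZ hmom s).integrable (by norm_num)).const_mul _]
  simp only [integral_const_mul, popMean]

theorem memLp_two_dotProduct (hZ : Measurable Z) (hmom : ∀ s, Integrable (fun ω => Z ω s ^ 4) P)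
    (w : Fin d → ℝ) : MemLp (fun ω => w ⬝ᵥ Z ω) 2 P :=
  memLp_finsetSum Finset.univ fun s _ => (memLp_two_coord hZ hmom s).const_mul (w s)

theorem variance_dotProduct_eq (hZ : Measurable Z) (hmom : ∀ s, Integrable (fun ω => Z ω s ^ 4) P)
    (w : Fin d → ℝ) : Var[fun ω => w ⬝ᵥ Z ω; P] = w ⬝ᵥ (popCov P Z *ᵥ w) :=
  variance_dotProduct (fun s => memLp_two_coord hZ hmom s) w

theorem measurable_dotProduct (w : Fin d → ℝ) : Measurable fun x : Fin d → ℝ => w ⬝ᵥ x :=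
  Finset.measurable_sum _ fun s _ => (measurable_pi_apply s).const_mul _

theorem measurable_influence (w : Fin d → ℝ) (q : ℝ) : Measurable (influence w q) := by
  have := measurable_dotProduct w
  unfold influence
  fun_prop

theorem memLp_two_influence (hZ : Measurable Z) (hmom : ∀ s, Integrable (fun ω => Z ω s ^ 4) P)
    (w : Fin d → ℝ) (q : ℝ) : MemLp (fun ω => influence w q (Z ω)) 2 P := by
  have hm : Measurable fun ω => w ⬝ᵥ Z ω - q := ((measurable_dotProduct w).comp hZ).sub_const _
  have h4 := integrable_dotProduct_pow_four hZ hmom w q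
  have h1 := memLp_two_mul hm hm h4 h4
  have h2 := (((memLp_two_dotProduct hZ hmom w).sub (memLp_const q)).const_mul 2).sub h1
  have h3 := h2.add (memLp_const q)
  refine h3.congr_norm ((measurable_influence w q).comp hZ).aestronglyMeasurable
    (ae_of_all _ fun ω => ?_)
  simp [influence, sq]

theorem variance_dotProduct_eq_quadForm (hZ : Measurable Z)
    (hmom : ∀ s, Integrable (fun ω => Z ω s ^ 4) P) (hcov : IsUnit (popCov P Z)) :
    Var[fun ω => (popMean P Z ᵥ* (popCov P Z)⁻¹) ⬝ᵥ Z ω; P]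
      = quadForm (popMean P Z) (popCov P Z) := by
  rw [variance_dotProduct_eq hZ hmom, mulVec_vecMul_inv hcov popCov_transpose,
    quadForm_eq_dotProduct]

theorem integral_influence (hZ : Measurable Z)
    (hmom : ∀ s, Integrable (fun ω => Z ω s ^ 4) P) (hcov : IsUnit (popCov P Z)) :
    ∫ ω, influence (popMean P Z ᵥ* (popCov P Z)⁻¹) (quadForm (popMean P Z) (popCov P Z)) (Z ω) ∂P
      = 0 := by
  set w := popMean P Z ᵥ* (popCov P Z)⁻¹ with hw
  set q := quadForm (popMean P Z) (popCov P Z) with hq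
  have hL := memLp_two_dotProduct hZ hmom w
  have hmean : ∫ ω, w ⬝ᵥ Z ω ∂P = q := by
    rw [integral_dotProduct hZ hmom, hq, quadForm_eq_dotProduct]
  have hvar := variance_dotProduct_eq_quadForm hZ hmom hcov
  rw [← hw, variance_eq_integral hL.1.aemeasurable, hmean, ← hq] at hvar
  have hi1 : Integrable (fun ω => w ⬝ᵥ Z ω - q) P :=
    (hL.integrable (by norm_num)).sub (integrable_const _)
  have hi2 : Integrable (fun ω => (w ⬝ᵥ Z ω - q) ^ 2) P := (hL.sub (memLp_const q)).integrable_sq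
  unfold influence
  have hi3 : Integrable (fun ω => 2 * (w ⬝ᵥ Z ω - q) - (w ⬝ᵥ Z ω - q) ^ 2) P :=
    (hi1.const_mul 2).sub hi2
  rw [integral_add hi3 (integrable_const _),
    integral_sub (hi1.const_mul 2) hi2, hvar, integral_const_mul,
    integral_sub (hL.integrable (by norm_num)) (integrable_const _), hmean]
  simp

/-- The quadratic form in `A(μ, Σ)` occurring in the asymptotic variance is the variance of the
influence function. -/
theorem variance_influence (hZ : Measurable Z)
    (hmom : ∀ s, Integrable (fun ω => Z ω s ^ 4) P) :
    Var[fun ω => influence (popMean P Z ᵥ* (popCov P Z)⁻¹)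
        (quadForm (popMean P Z) (popCov P Z)) (Z ω); P]
      = Avec (popMean P Z) (popCov P Z) ⬝ᵥ
        ((Matrix.of fun α β => cov[fun ω => feature (Z ω) α, fun ω => feature (Z ω) β; P]) *ᵥ
          Avec (popMean P Z) (popCov P Z)) := by
  rw [← variance_dotProduct fun α => memLp_two_feature hZ hmom α]
  simp only [Avec_dotProduct_feature, ← quadForm_eq_dotProduct]
  set w := popMean P Z ᵥ* (popCov P Z)⁻¹ with hw
  set q := quadForm (popMean P Z) (popCov P Z) with hq
  have : ∀ ω, influence w q (Z ω)
      = (2 * (w ⬝ᵥ Z ω) + 2 * q * (w ⬝ᵥ Z ω) - (w ⬝ᵥ Z ω) ^ 2) + (-q - q ^ 2) := fun ω => by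
    simp only [influence]; ring
  simp only [this]
  refine variance_add_const ?_ _
  have hm : Measurable fun ω => w ⬝ᵥ Z ω := (measurable_dotProduct w).comp hZ
  exact Measurable.aestronglyMeasurable (by fun_prop)

/-- The asymptotic variance does not degenerate. If the influence function, a quadratic polynomial in
`w · Z`, were almost surely constant, then `w · Z` would take at most two values, and some coordinate
would be conditionally two-point distributed. Likewise `q = Var(w · Z)` cannot vanish. -/
theorem quadForm_pos_and_variance_influence_pos (hZ : Measurable Z)
    (hmom : ∀ s, Integrable (fun ω => Z ω s ^ 4) P) (hcov : IsUnit (popCov P Z))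
    (hmean : popMean P Z ≠ 0) (htwo : ∀ s, ¬ IsCondTwoPoint P Z s) :
    0 < quadForm (popMean P Z) (popCov P Z) ∧
    0 < Var[fun ω => influence (popMean P Z ᵥ* (popCov P Z)⁻¹)
        (quadForm (popMean P Z) (popCov P Z)) (Z ω); P] := by
  have hvar := variance_dotProduct_eq_quadForm hZ hmom hcov
  have hint := integral_influence hZ hmom hcov
  set w := popMean P Z ᵥ* (popCov P Z)⁻¹ with hw
  set q := quadForm (popMean P Z) (popCov P Z) with hq
  have hw0 : w ≠ 0 := fun h => hmean <| by
    rw [← mulVec_vecMul_inv hcov popCov_transpose (popMean P Z), ← hw, h, Matrix.mulVec_zero]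
  have hkey : ∀ c₁ c₂ : ℝ, ¬ ∀ᵐ ω ∂P, w ⬝ᵥ Z ω = c₁ ∨ w ⬝ᵥ Z ω = c₂ := fun c₁ c₂ h =>
    (exists_isCondTwoPoint_of_ae_dotProduct hZ hw0 h).elim htwo
  constructor
  · refine lt_of_le_of_ne (hvar ▸ variance_nonneg _ _) fun h0 => ?_
    have h := ae_eq_integral_of_variance_eq_zero (memLp_two_dotProduct hZ hmom w)
      (hvar.trans h0.symm)
    exact hkey _ 0 (h.mono fun ω hω => Or.inl hω)
  · refine lt_of_le_of_ne (variance_nonneg _ _) fun h0 => ?_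
    have h := ae_eq_integral_of_variance_eq_zero (memLp_two_influence hZ hmom w q) h0.symm
    rw [hint] at h
    -- the influence function vanishes exactly where `(w · Z - q - 1)² = 1 + q`
    refine hkey (q + 1 + √(1 + q)) (q + 1 - √(1 + q)) (h.mono fun ω hω => ?_)
    have h2 : (w ⬝ᵥ Z ω - q - 1) ^ 2 = 1 + q := by
      simp only [influence] at hω; linarith
    have h3 : |w ⬝ᵥ Z ω - q - 1| = √(1 + q) := by rw [← h2, Real.sqrt_sq_eq_abs]
    rcases abs_eq (Real.sqrt_nonneg _) |>.1 h3 with h4 | h4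
    · left; linarith
    · right; linarith

end Population

/-! ### Algebra of empirical moments -/

section Deterministic

variable {d : ℕ}

theorem empCov_apply (n : ℕ) (x : ℕ → Fin d → ℝ) (r t : Fin d) :
    empCov n x r t = avg n (fun j => x j r * x j t)
      - avg n (fun j => x j r) * avg n (fun j => x j t) := by
  rcases eq_or_ne n 0 with rfl | hn
  · simp [empCov, avg]
  have hn' : (n : ℝ) ≠ 0 := by exact_mod_cast hn
  simp only [empCov, Matrix.of_apply, empMean]
  set a := avg n fun j => x j r with ha
  set b := avg n fun j => x j t with hb
  have ha' : ∑ j ∈ Finset.range n, x j r = n * a := by rw [ha, avg]; field_simp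
  have hb' : ∑ j ∈ Finset.range n, x j t = n * b := by rw [hb, avg]; field_simp
  have h : ∑ j ∈ Finset.range n, (x j r - a) * (x j t - b)
      = ∑ j ∈ Finset.range n, x j r * x j t - n * a * b := by
    have : ∀ j, (x j r - a) * (x j t - b) = x j r * x j t - x j r * b - a * x j t + a * b :=
      fun j => by ring
    simp only [this, Finset.sum_add_distrib, Finset.sum_sub_distrib, ← Finset.sum_mul,
      ← Finset.mul_sum, ha', hb', Finset.sum_const, Finset.card_range, nsmul_eq_mul]
    ring
  rw [avg, h, avg]
  field_simp

theorem empCov_transpose (n : ℕ) (x : ℕ → Fin d → ℝ) : (empCov n x)ᵀ = empCov n x := by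
  ext r t
  simp only [Matrix.transpose_apply, empCov, Matrix.of_apply, mul_comm]

/-- The block matrix of the variance estimator is the empirical covariance matrix of the
features. -/
theorem fromBlocks_apply (n : ℕ) (x : ℕ → Fin d → ℝ) (α β : Fin d ⊕ (Fin d × Fin d)) :
    Matrix.fromBlocks (empCov n x) (empPsi3 n x)ᵀ (empPsi3 n x) (empPsi4 n x) α β
      = avg n (fun j => feature (x j) α * feature (x j) β)
        - avg n (fun j => feature (x j) α) * avg n (fun j => feature (x j) β) := by
  rcases α with r | ab <;> rcases β with t | ce
  · simp [feature, empCov_apply]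
  · simp only [feature, empPsi3, Matrix.fromBlocks_apply₁₂, Matrix.transpose_apply,
      Matrix.of_apply, Sum.elim_inl, Sum.elim_inr, mul_comm]
  · simp only [feature, empPsi3, Matrix.fromBlocks_apply₂₁, Matrix.of_apply, Sum.elim_inl,
      Sum.elim_inr]
  · simp only [feature, empPsi4, Matrix.fromBlocks_apply₂₂, Matrix.of_apply, Sum.elim_inr,
      mul_assoc]

/-- `A(m, S)` depends on `S` only through `m ᵥ* S⁻¹`, the second component of `p` here, and the
dependence on `(m, m ᵥ* S⁻¹)` is continuous. -/
theorem continuous_Avec_aux (α : Fin d ⊕ (Fin d × Fin d)) :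
    Continuous fun p : (Fin d → ℝ) × (Fin d → ℝ) =>
      Sum.elim ((2 : ℝ) • p.2 - kronVec p.2 p.2 ᵥ* Dtilde p.1) (-kronVec p.2 p.2) α := by
  have hD : ∀ ar s, Continuous fun p : (Fin d → ℝ) × (Fin d → ℝ) => Dtilde p.1 ar s := by
    intro ar s
    simp only [Dtilde, Matrix.of_apply]
    split_ifs <;> fun_prop
  rcases α with s | ab
  · simp only [Sum.elim_inl, Pi.sub_apply, Pi.smul_apply, Matrix.vecMul, dotProduct, kronVec]
    fun_prop
  · simp only [Sum.elim_inr, Pi.neg_apply, kronVec]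
    fun_prop

theorem avg_eq_of_ne_zero {n : ℕ} (hn : n ≠ 0) (f : ℕ → ℝ) (a b : ℝ) :
    avg n (fun j => a * f j + b) = a * avg n f + b := by
  have hn' : (n : ℝ) ≠ 0 := by exact_mod_cast hn
  simp only [avg, Finset.sum_add_distrib, ← Finset.mul_sum, Finset.sum_const, Finset.card_range,
    nsmul_eq_mul]
  field_simp

theorem avg_add (n : ℕ) (f g : ℕ → ℝ) : avg n (fun j => f j + g j) = avg n f + avg n g := by
  simp only [avg, Finset.sum_add_distrib, mul_add]

theorem avg_const_mul (n : ℕ) (a : ℝ) (f : ℕ → ℝ) : avg n (fun j => a * f j) = a * avg n f := by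
  simp only [avg, ← Finset.mul_sum]; ring

theorem avg_sum {ι : Type*} (t : Finset ι) (n : ℕ) (f : ι → ℕ → ℝ) :
    avg n (fun j => ∑ i ∈ t, f i j) = ∑ i ∈ t, avg n (f i) := by
  simp only [avg]
  rw [Finset.sum_comm, Finset.mul_sum]

theorem avg_dotProduct (n : ℕ) (x : ℕ → Fin d → ℝ) (w : Fin d → ℝ) :
    avg n (fun j => w ⬝ᵥ x j) = w ⬝ᵥ empMean n x := by
  simp only [dotProduct, avg_sum, avg_const_mul, empMean]

theorem empCov_mulVec (n : ℕ) (x : ℕ → Fin d → ℝ) (w : Fin d → ℝ) (r : Fin d) :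
    (empCov n x *ᵥ w) r = avg n (fun j => x j r * (w ⬝ᵥ x j))
      - avg n (fun j => x j r) * avg n (fun j => w ⬝ᵥ x j) := by
  have h : ∀ j, x j r * (w ⬝ᵥ x j) = ∑ t, w t * (x j r * x j t) := fun j => by
    simp only [dotProduct, Finset.mul_sum]
    exact Finset.sum_congr rfl fun t _ => by ring
  simp only [Matrix.mulVec, empCov_apply, h, avg_sum, avg_const_mul]
  simp only [dotProduct, avg_sum, avg_const_mul, Finset.mul_sum, ← Finset.sum_sub_distrib]
  exact Finset.sum_congr rfl fun t _ => by ring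

theorem dotProduct_empCov_mulVec (n : ℕ) (x : ℕ → Fin d → ℝ) (w : Fin d → ℝ) :
    w ⬝ᵥ (empCov n x *ᵥ w) = avg n (fun j => (w ⬝ᵥ x j) ^ 2) - avg n (fun j => w ⬝ᵥ x j) ^ 2 := by
  have h : ∀ j, (w ⬝ᵥ x j) ^ 2 = ∑ r, w r * (x j r * (w ⬝ᵥ x j)) := fun j => by
    rw [sq]
    nth_rewrite 1 [dotProduct]
    rw [Finset.sum_mul]
    exact Finset.sum_congr rfl fun t _ => by ring
  have h2 : avg n (fun j => w ⬝ᵥ x j) ^ 2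
      = ∑ r, w r * (avg n (fun j => x j r) * avg n (fun j => w ⬝ᵥ x j)) := by
    rw [sq]
    nth_rewrite 1 [avg_dotProduct]
    rw [dotProduct, Finset.sum_mul]
    exact Finset.sum_congr rfl fun t _ => by rw [empMean]; ring
  rw [h2]
  simp only [h, avg_sum, avg_const_mul]
  rw [← Finset.sum_sub_distrib, dotProduct]
  exact Finset.sum_congr rfl fun t _ => by rw [empCov_mulVec]; ring

/-- The linear part of the `r`-th coordinate of `m̂ - Σ̂ w`, as a function of one observation; here
`w = Σ⁻¹ m` and `q = w · m`. -/
def residual (m w : Fin d → ℝ) (q : ℝ) (r : Fin d) (x : Fin d → ℝ) : ℝ :=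
  x r - (x r - m r) * (w ⬝ᵥ x - q)

theorem empMean_sub_empCov_mulVec {n : ℕ} (hn : n ≠ 0) (x : ℕ → Fin d → ℝ) (m w : Fin d → ℝ)
    (q : ℝ) (r : Fin d) : (empMean n x - empCov n x *ᵥ w) r = avg n (fun j => residual m w q r (x j))
      + avg n (fun j => x j r - m r) * avg n (fun j => w ⬝ᵥ x j - q) := by
  have h1 : avg n (fun j => x j r - m r) = avg n (fun j => x j r) - m r := by
    simpa [sub_eq_add_neg] using avg_eq_of_ne_zero hn (fun j => x j r) 1 (-m r)
  have h2 : avg n (fun j => w ⬝ᵥ x j - q) = avg n (fun j => w ⬝ᵥ x j) - q := by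
    simpa [sub_eq_add_neg] using avg_eq_of_ne_zero hn (fun j => w ⬝ᵥ x j) 1 (-q)
  have h3 : avg n (fun j => residual m w q r (x j)) = (1 + q) * avg n (fun j => x j r)
      + (-1 * avg n (fun j => x j r * (w ⬝ᵥ x j)) + (m r * avg n (fun j => w ⬝ᵥ x j) + -(m r * q))) := by
    rw [← avg_eq_of_ne_zero hn (fun j => w ⬝ᵥ x j), ← avg_const_mul n (1 + q),
      ← avg_const_mul n (-1), ← avg_add, ← avg_add]
    congr 1
    funext j
    simp only [residual]
    ring
  rw [h1, h2, h3, Pi.sub_apply, empCov_mulVec, empMean]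
  ring

/-- Up to products of centred averages, `q̂ - q` is the average of the influence function. -/
theorem empQuad_sub {n : ℕ} (hn : n ≠ 0) (x : ℕ → Fin d → ℝ) (hS : IsUnit (empCov n x))
    (w : Fin d → ℝ) (q : ℝ) : empQuad n x - q = avg n (fun j => influence w q (x j))
      + avg n (fun j => w ⬝ᵥ x j - q) ^ 2
      + (empMean n x - empCov n x *ᵥ w) ⬝ᵥ
        ((empCov n x)⁻¹ *ᵥ (empMean n x - empCov n x *ᵥ w)) := by
  have h2 : avg n (fun j => w ⬝ᵥ x j - q) = avg n (fun j => w ⬝ᵥ x j) - q := by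
    simpa [sub_eq_add_neg] using avg_eq_of_ne_zero hn (fun j => w ⬝ᵥ x j) 1 (-q)
  have h3 : avg n (fun j => influence w q (x j)) = (-1 * avg n (fun j => (w ⬝ᵥ x j) ^ 2))
      + ((2 + 2 * q) * avg n (fun j => w ⬝ᵥ x j) + (-q - q ^ 2)) := by
    rw [← avg_eq_of_ne_zero hn (fun j => w ⬝ᵥ x j), ← avg_const_mul n (-1), ← avg_add]
    congr 1
    funext j
    simp only [influence]
    ring
  rw [h2, h3, empQuad, quadForm_eq_add hS (empCov_transpose n x) _ w, dotProduct_empCov_mulVec,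
    ← avg_dotProduct]
  ring

end Deterministic

section OneSample

variable {Ω : Type*} [MeasurableSpace Ω] {P : Measure Ω}

/-! ### Measurability of the estimators -/

section Measurability

variable {d : ℕ} {Y : ℕ → Ω → Fin d → ℝ}

theorem measurable_empMean_apply (hY : ∀ j, Measurable (Y j)) (n : ℕ) (r : Fin d) :
    Measurable fun ω => empMean n (fun j => Y j ω) r :=
  measurable_avg (fun j => (measurable_pi_apply r).comp (hY j)) n

theorem measurable_avg_feature_mul (hY : ∀ j, Measurable (Y j)) (n : ℕ)
    (α β : Fin d ⊕ (Fin d × Fin d)) :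
    Measurable fun ω => avg n fun j => feature (Y j ω) α * feature (Y j ω) β :=
  measurable_avg (fun j => ((measurable_feature α).comp (hY j)).mul
    ((measurable_feature β).comp (hY j))) n

theorem measurable_fromBlocks_apply (hY : ∀ j, Measurable (Y j)) (n : ℕ)
    (α β : Fin d ⊕ (Fin d × Fin d)) :
    Measurable fun ω => Matrix.fromBlocks (empCov n fun j => Y j ω) (empPsi3 n fun j => Y j ω)ᵀ
      (empPsi3 n fun j => Y j ω) (empPsi4 n fun j => Y j ω) α β := by
  simp only [fromBlocks_apply]
  exact (measurable_avg_feature_mul hY n α β).sub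
    ((measurable_avg (fun j => (measurable_feature α).comp (hY j)) n).mul
      (measurable_avg (fun j => (measurable_feature β).comp (hY j)) n))

theorem measurable_vecMul_inv (hY : ∀ j, Measurable (Y j)) (n : ℕ) :
    Measurable fun ω => (empMean n fun j => Y j ω) ᵥ* (empCov n fun j => Y j ω)⁻¹ := by
  have hcov : ∀ a b, Measurable fun ω => empCov n (fun j => Y j ω) a b := fun a b =>
    measurable_fromBlocks_apply hY n (Sum.inl a) (Sum.inl b)
  refine measurable_pi_lambda _ fun t => ?_
  simp only [Matrix.vecMul, dotProduct]
  exact Finset.measurable_sum _ fun s _ =>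
    (measurable_empMean_apply hY n s).mul (measurable_nonsing_inv_apply hcov s t)

theorem measurable_empQuad (hY : ∀ j, Measurable (Y j)) (n : ℕ) :
    Measurable fun ω => empQuad n fun j => Y j ω := by
  simp only [empQuad, quadForm_eq_dotProduct]
  exact Finset.measurable_sum _ fun s _ =>
    ((measurable_pi_apply s).comp (measurable_vecMul_inv hY n)).mul (measurable_empMean_apply hY n s)

theorem measurable_Avec_apply (hY : ∀ j, Measurable (Y j)) (n : ℕ) (α : Fin d ⊕ (Fin d × Fin d)) :
    Measurable fun ω => Avec (empMean n fun j => Y j ω) (empCov n fun j => Y j ω) α :=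
  (continuous_Avec_aux α).measurable.comp
    ((measurable_pi_lambda _ (measurable_empMean_apply hY n)).prodMk (measurable_vecMul_inv hY n))

theorem measurable_varC (hY : ∀ j, Measurable (Y j)) (N n : ℕ) :
    Measurable fun ω => varC N n fun j => Y j ω := by
  refine Measurable.mul ((((measurable_empQuad hY n).pow_const 3).inv.const_mul _).div_const _) ?_
  exact Finset.measurable_sum _ fun α _ => (measurable_Avec_apply hY n α).mul
    (Finset.measurable_sum _ fun β _ => (measurable_fromBlocks_apply hY n α β).mul
      (measurable_Avec_apply hY n β))

theorem measurable_varB (hY : ∀ j, Measurable (Y j)) (N n : ℕ) :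
    Measurable fun ω => varB N n fun j => Y j ω :=
  ((measurable_empQuad hY n).pow_const 2).mul (measurable_varC hY N n)

end Measurability

/-! ### Consistency of the estimators -/

section Consistency

variable [IsProbabilityMeasure P] {d : ℕ} {Y : ℕ → Ω → Fin d → ℝ} {s : ℕ → ℕ}

theorem tendsto_fromBlocks (hY : IsIIDSample P Y)
    (hmom : ∀ t, Integrable (fun ω => Y 0 ω t ^ 4) P) (hs : Tendsto s atTop atTop) :
    Tendsto (fun z : ℕ × Ω => Matrix.fromBlocks (empCov (s z.1) fun j => Y j z.2)
      (empPsi3 (s z.1) fun j => Y j z.2)ᵀ (empPsi3 (s z.1) fun j => Y j z.2)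
      (empPsi4 (s z.1) fun j => Y j z.2)) (probFilter P)
      (𝓝 (Matrix.of fun α β => cov[fun ω => feature (Y 0 ω) α, fun ω => feature (Y 0 ω) β; P])) := by
  refine tendsto_pi_nhds.2 fun α => tendsto_pi_nhds.2 fun β => ?_
  have hf := memLp_two_feature (hY.measurable 0) hmom
  simp only [fromBlocks_apply, Matrix.of_apply]
  rw [covariance_eq_sub (hf α) (hf β)]
  have h1 : ∀ α, Tendsto (fun z : ℕ × Ω => avg (s z.1) fun j => feature (Y j z.2) α)
      (probFilter P) (𝓝 (∫ ω, feature (Y 0 ω) α ∂P)) := fun α =>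
    (hY.comp (measurable_feature α)).tendsto_avg ((hf α).integrable (by norm_num)) hs
  have h2 := (hY.comp ((measurable_feature α).mul (measurable_feature β))).tendsto_avg
    ((hf α).integrable_mul (hf β)) hs
  exact h2.sub ((h1 α).mul (h1 β))

theorem tendsto_empMean (hY : IsIIDSample P Y)
    (hmom : ∀ t, Integrable (fun ω => Y 0 ω t ^ 4) P) (hs : Tendsto s atTop atTop) :
    Tendsto (fun z : ℕ × Ω => empMean (s z.1) fun j => Y j z.2) (probFilter P)
      (𝓝 (popMean P (Y 0))) :=
  tendsto_pi_nhds.2 fun t => (hY.comp (measurable_pi_apply t)).tendsto_avg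
    ((memLp_two_coord (hY.measurable 0) hmom t).integrable (by norm_num)) hs

theorem tendsto_empCov (hY : IsIIDSample P Y)
    (hmom : ∀ t, Integrable (fun ω => Y 0 ω t ^ 4) P) (hs : Tendsto s atTop atTop) :
    Tendsto (fun z : ℕ × Ω => empCov (s z.1) fun j => Y j z.2) (probFilter P)
      (𝓝 (popCov P (Y 0))) :=
  tendsto_pi_nhds.2 fun a => tendsto_pi_nhds.2 fun b =>
    tendsto_pi_nhds.1 (tendsto_pi_nhds.1 (tendsto_fromBlocks hY hmom hs) (Sum.inl a)) (Sum.inl b)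

theorem tendsto_vecMul_inv (hY : IsIIDSample P Y)
    (hmom : ∀ t, Integrable (fun ω => Y 0 ω t ^ 4) P) (hs : Tendsto s atTop atTop)
    (hcov : IsUnit (popCov P (Y 0))) :
    Tendsto (fun z : ℕ × Ω => (empMean (s z.1) fun j => Y j z.2) ᵥ* (empCov (s z.1) fun j => Y j z.2)⁻¹)
      (probFilter P) (𝓝 (popMean P (Y 0) ᵥ* (popCov P (Y 0))⁻¹)) := by
  have h1 := tendsto_empMean hY hmom hs
  have h2 := tendsto_nonsing_inv (tendsto_empCov hY hmom hs) hcov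
  have hc : Continuous fun p : (Fin d → ℝ) × Matrix (Fin d) (Fin d) ℝ => p.1 ᵥ* p.2 := by fun_prop
  exact (hc.tendsto _).comp (h1.prodMk_nhds h2)

theorem tendsto_empQuad (hY : IsIIDSample P Y)
    (hmom : ∀ t, Integrable (fun ω => Y 0 ω t ^ 4) P) (hs : Tendsto s atTop atTop)
    (hcov : IsUnit (popCov P (Y 0))) :
    Tendsto (fun z : ℕ × Ω => empQuad (s z.1) fun j => Y j z.2) (probFilter P)
      (𝓝 (quadForm (popMean P (Y 0)) (popCov P (Y 0)))) := by
  have hc : Continuous fun p : (Fin d → ℝ) × (Fin d → ℝ) => p.1 ⬝ᵥ p.2 := by fun_prop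
  simp only [empQuad, quadForm_eq_dotProduct]
  have h := (tendsto_vecMul_inv hY hmom hs hcov).prodMk_nhds (tendsto_empMean hY hmom hs)
  exact (hc.tendsto _).comp h

theorem tendsto_Avec (hY : IsIIDSample P Y)
    (hmom : ∀ t, Integrable (fun ω => Y 0 ω t ^ 4) P) (hs : Tendsto s atTop atTop)
    (hcov : IsUnit (popCov P (Y 0))) :
    Tendsto (fun z : ℕ × Ω => Avec (empMean (s z.1) fun j => Y j z.2) (empCov (s z.1) fun j => Y j z.2))
      (probFilter P) (𝓝 (Avec (popMean P (Y 0)) (popCov P (Y 0)))) :=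
  tendsto_pi_nhds.2 fun α => by
    have h := (tendsto_empMean hY hmom hs).prodMk_nhds (tendsto_vecMul_inv hY hmom hs hcov)
    exact ((continuous_Avec_aux α).tendsto _).comp h

variable {N : ℕ → ℕ} {κ : ℝ}

theorem tendsto_varC (hY : IsIIDSample P Y)
    (hmom : ∀ t, Integrable (fun ω => Y 0 ω t ^ 4) P) (hs : Tendsto s atTop atTop)
    (hcov : IsUnit (popCov P (Y 0))) (hq : 0 < quadForm (popMean P (Y 0)) (popCov P (Y 0)))
    (hκ0 : 0 < κ) (hκ : Tendsto (fun m => (s m : ℝ) / (N m : ℝ)) atTop (𝓝 κ)) :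
    Tendsto (fun z : ℕ × Ω => varC (N z.1) (s z.1) fun j => Y j z.2) (probFilter P)
      (𝓝 (κ⁻¹ * (quadForm (popMean P (Y 0)) (popCov P (Y 0)) ^ 3)⁻¹ / 4 *
        Var[fun ω => influence (popMean P (Y 0) ᵥ* (popCov P (Y 0))⁻¹)
          (quadForm (popMean P (Y 0)) (popCov P (Y 0))) (Y 0 ω); P])) := by
  rw [variance_influence (hY.measurable 0) hmom]
  have hA := tendsto_Avec hY hmom hs hcov
  have hB := tendsto_fromBlocks hY hmom hs
  have hQ := ((tendsto_empQuad hY hmom hs hcov).pow 3).inv₀ (pow_pos hq 3).ne'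
  have hN := ((hκ.inv₀ hκ0.ne').comp (tendsto_fst_probFilter P))
  have hc : Continuous fun p : (Fin d ⊕ (Fin d × Fin d) → ℝ) ×
      Matrix (Fin d ⊕ (Fin d × Fin d)) (Fin d ⊕ (Fin d × Fin d)) ℝ =>
      p.1 ⬝ᵥ (p.2 *ᵥ p.1) := by fun_prop
  have h := (((hN.mul hQ).div_const 4).mul ((hc.tendsto _).comp (hA.prodMk_nhds hB)))
  refine h.congr fun z => ?_
  simp only [Function.comp_apply, varC, inv_div]
  ring

theorem tendsto_varB (hY : IsIIDSample P Y)
    (hmom : ∀ t, Integrable (fun ω => Y 0 ω t ^ 4) P) (hs : Tendsto s atTop atTop)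
    (hcov : IsUnit (popCov P (Y 0))) (hq : 0 < quadForm (popMean P (Y 0)) (popCov P (Y 0)))
    (hκ0 : 0 < κ) (hκ : Tendsto (fun m => (s m : ℝ) / (N m : ℝ)) atTop (𝓝 κ)) :
    Tendsto (fun z : ℕ × Ω => varB (N z.1) (s z.1) fun j => Y j z.2) (probFilter P)
      (𝓝 (κ⁻¹ * (quadForm (popMean P (Y 0)) (popCov P (Y 0)))⁻¹ / 4 *
        Var[fun ω => influence (popMean P (Y 0) ᵥ* (popCov P (Y 0))⁻¹)
          (quadForm (popMean P (Y 0)) (popCov P (Y 0))) (Y 0 ω); P])) := by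
  have h := ((tendsto_empQuad hY hmom hs hcov).pow 2).mul (tendsto_varC hY hmom hs hcov hq hκ0 hκ)
  refine h.trans (le_of_eq (congrArg 𝓝 ?_))
  have := hq.ne'
  field_simp

/-! ### Linearization of the empirical quadratic form -/

/-- The factor `N^(1/4)` is of smaller order than the square root of the group size. -/
theorem tendsto_sqrt_sqrt_sq_div (hN : Tendsto N atTop atTop) (hκ0 : 0 < κ)
    (hκ : Tendsto (fun m => (s m : ℝ) / (N m : ℝ)) atTop (𝓝 κ)) :
    Tendsto (fun i => √(√(N i : ℝ)) ^ 2 * (s i : ℝ)⁻¹) atTop (𝓝 0) := by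
  have h1 : Tendsto (fun i => (√(N i : ℝ))⁻¹) atTop (𝓝 0) :=
    tendsto_inv_atTop_zero.comp (Real.tendsto_sqrt_atTop.comp
      (tendsto_natCast_atTop_atTop.comp hN))
  have h2 := (hκ.inv₀ hκ0.ne').mul h1
  rw [mul_zero] at h2
  refine h2.congr fun i => ?_
  have h3 : √(N i : ℝ) = N i * (√(N i : ℝ))⁻¹ := by rw [← div_eq_mul_inv, Real.div_sqrt]
  rw [Real.sq_sqrt (Real.sqrt_nonneg _), inv_div]
  calc (N i : ℝ) / s i * (√(N i : ℝ))⁻¹ = (N i * (√(N i : ℝ))⁻¹) * (s i : ℝ)⁻¹ := by ring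
    _ = √(N i : ℝ) * (s i : ℝ)⁻¹ := by rw [← h3]

theorem memLp_two_residual {Z : Ω → Fin d → ℝ} (hZ : Measurable Z)
    (hmom : ∀ t, Integrable (fun ω => Z ω t ^ 4) P) (m w : Fin d → ℝ) (q : ℝ) (t : Fin d) :
    MemLp (fun ω => residual m w q t (Z ω)) 2 P := by
  refine (memLp_two_coord hZ hmom t).sub (memLp_two_mul ?_ ?_ ?_ ?_)
  · exact ((measurable_pi_apply t).comp hZ).sub_const _
  · exact ((measurable_dotProduct w).comp hZ).sub_const q
  · simpa using integrable_dotProduct_pow_four hZ hmom (Pi.single t 1) (m t)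
  · exact integrable_dotProduct_pow_four hZ hmom w q

theorem measurable_residual (m w : Fin d → ℝ) (q : ℝ) (t : Fin d) :
    Measurable (residual m w q t) := by
  have := measurable_dotProduct w
  unfold residual
  fun_prop

theorem integral_residual {Z : Ω → Fin d → ℝ} (hZ : Measurable Z)
    (hmom : ∀ t, Integrable (fun ω => Z ω t ^ 4) P) {w : Fin d → ℝ}
    (hw : popCov P Z *ᵥ w = popMean P Z) (t : Fin d) :
    ∫ ω, residual (popMean P Z) w (w ⬝ᵥ popMean P Z) t (Z ω) ∂P = 0 := by
  have hcoord := memLp_two_coord hZ hmom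
  have hcov : cov[fun ω => Z ω t, fun ω => w ⬝ᵥ Z ω; P] = popMean P Z t := by
    rw [← hw]
    simp only [dotProduct]
    rw [covariance_fun_sum_right (fun u => (hcoord u).const_mul (w u)) (hcoord t)]
    simp only [covariance_const_mul_right, Matrix.mulVec, dotProduct, popCov, Matrix.of_apply]
    exact Finset.sum_congr rfl fun u _ => mul_comm _ _
  rw [covariance, integral_dotProduct hZ hmom] at hcov
  simp only [residual]
  rw [integral_sub ((hcoord t).integrable (by norm_num))]
  · exact sub_eq_zero.2 hcov.symm
  · exact ((hcoord t).sub (memLp_const _)).integrable_mul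
      ((memLp_two_dotProduct hZ hmom w).sub (memLp_const _))

/-- The quantities entering the remainder of the linearization quadratically are negligible even
after multiplication by `a m`; for `a = N^(1/4)` their squares are `o_P(N^(-1/2))`. -/
theorem tendsto_smul_empMean_sub (hY : IsIIDSample P Y)
    (hmom : ∀ t, Integrable (fun ω => Y 0 ω t ^ 4) P) (hs : Tendsto s atTop atTop)
    {w : Fin d → ℝ} (hw : popCov P (Y 0) *ᵥ w = popMean P (Y 0)) {a : ℕ → ℝ}
    (ha : Tendsto (fun i => a i ^ 2 * (s i : ℝ)⁻¹) atTop (𝓝 0)) :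
    Tendsto (fun z : ℕ × Ω => a z.1 * avg (s z.1) fun j => w ⬝ᵥ Y j z.2 - w ⬝ᵥ popMean P (Y 0))
      (probFilter P) (𝓝 0) ∧
    Tendsto (fun z : ℕ × Ω => a z.1 • ((empMean (s z.1) fun j => Y j z.2)
      - (empCov (s z.1) fun j => Y j z.2) *ᵥ w)) (probFilter P) (𝓝 0) := by
  have hZ := hY.measurable 0
  have hcoord := memLp_two_coord hZ hmom
  have hL := memLp_two_dotProduct hZ hmom w
  have hcent : ∀ t, MemLp (fun ω => Y 0 ω t - popMean P (Y 0) t) 2 P := fun t =>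
    (hcoord t).sub (memLp_const _)
  have hcent0 : ∀ t, ∫ ω, Y 0 ω t - popMean P (Y 0) t ∂P = 0 := fun t => by
    rw [integral_sub ((hcoord t).integrable (by norm_num)) (integrable_const _)]
    simp [popMean]
  have hLc : MemLp (fun ω => w ⬝ᵥ Y 0 ω - w ⬝ᵥ popMean P (Y 0)) 2 P := hL.sub (memLp_const _)
  have hLc0 : ∫ ω, w ⬝ᵥ Y 0 ω - w ⬝ᵥ popMean P (Y 0) ∂P = 0 := by
    rw [integral_sub (hL.integrable (by norm_num)) (integrable_const _),
      integral_dotProduct hZ hmom]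
    simp
  have hYL := hY.comp ((measurable_dotProduct w).sub_const (w ⬝ᵥ popMean P (Y 0)))
  have hL1 := hYL.tendsto_mul_avg_zero hLc hLc0 ha
  have hL2 := hYL.tendsto_avg (hLc.integrable (by norm_num)) hs
  rw [hLc0] at hL2
  refine ⟨hL1, tendsto_pi_nhds.2 fun t => ?_⟩
  have hX1 := (hY.comp ((measurable_pi_apply t).sub_const (popMean P (Y 0) t))).tendsto_mul_avg_zero
    (hcent t) (hcent0 t) ha
  have hR1 := (hY.comp (measurable_residual (popMean P (Y 0)) w (w ⬝ᵥ popMean P (Y 0))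
    t)).tendsto_mul_avg_zero (memLp_two_residual hZ hmom _ _ _ _)
    (integral_residual hZ hmom hw t) ha
  have h := hR1.add (hX1.mul hL2)
  rw [mul_zero, add_zero] at h
  refine h.congr' ?_
  filter_upwards [(tendsto_fst_probFilter P).eventually (hs.eventually_ne_atTop 0)] with z hz
  rw [Pi.smul_apply, empMean_sub_empCov_mulVec hz _ (popMean P (Y 0)) w (w ⬝ᵥ popMean P (Y 0)) t,
    smul_eq_mul]
  ring

/-- The asymptotic linearization `√N (q̂ - q) = √N ⟨influence⟩ + o_P(1)`. -/
theorem tendsto_empQuad_sub_avg_influence (hY : IsIIDSample P Y)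
    (hmom : ∀ t, Integrable (fun ω => Y 0 ω t ^ 4) P) (hs : Tendsto s atTop atTop)
    (hcov : IsUnit (popCov P (Y 0))) (hN : Tendsto N atTop atTop)
    (hκ0 : 0 < κ) (hκ : Tendsto (fun m => (s m : ℝ) / (N m : ℝ)) atTop (𝓝 κ)) :
    Tendsto (fun z : ℕ × Ω => √(N z.1) * (empQuad (s z.1) (fun j => Y j z.2)
        - quadForm (popMean P (Y 0)) (popCov P (Y 0)))
      - √(N z.1) * avg (s z.1) (fun j => influence (popMean P (Y 0) ᵥ* (popCov P (Y 0))⁻¹)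
        (quadForm (popMean P (Y 0)) (popCov P (Y 0))) (Y j z.2))) (probFilter P) (𝓝 0) := by
  obtain ⟨hL, hu⟩ := tendsto_smul_empMean_sub hY hmom hs
    (mulVec_vecMul_inv hcov popCov_transpose (popMean P (Y 0))) (tendsto_sqrt_sqrt_sq_div hN hκ0 hκ)
  rw [← quadForm_eq_dotProduct] at hL
  have hc : Continuous fun p : (Fin d → ℝ) × Matrix (Fin d) (Fin d) ℝ =>
      p.1 ⬝ᵥ (p.2 *ᵥ p.1) := by fun_prop
  have hquad := (hc.tendsto _).comp (hu.prodMk_nhds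
    (tendsto_nonsing_inv (tendsto_empCov hY hmom hs) hcov))
  have h := (hL.pow 2).add hquad
  simp only [zero_dotProduct, ne_eq, OfNat.ofNat_ne_zero, not_false_eq_true, zero_pow,
    add_zero] at h
  refine h.congr' ?_
  filter_upwards [(tendsto_fst_probFilter P).eventually (hs.eventually_ne_atTop 0),
    eventually_isUnit (tendsto_empCov hY hmom hs) hcov] with z hz hunit
  rw [empQuad_sub hz _ hunit (popMean P (Y 0) ᵥ* (popCov P (Y 0))⁻¹)]
  simp only [Function.comp_apply, Matrix.mulVec_smul, smul_dotProduct, dotProduct_smul, smul_eq_mul]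
  have hsq := Real.mul_self_sqrt (Real.sqrt_nonneg (N z.1 : ℝ))
  generalize avg (s z.1) (fun j => popMean P (Y 0) ᵥ* (popCov P (Y 0))⁻¹ ⬝ᵥ Y j z.2 -
    quadForm (popMean P (Y 0)) (popCov P (Y 0))) = b
  generalize (empMean (s z.1) fun j => Y j z.2) - (empCov (s z.1) fun j => Y j z.2) *ᵥ
    (popMean P (Y 0) ᵥ* (popCov P (Y 0))⁻¹) = u
  linear_combination (b ^ 2 + u ⬝ᵥ ((empCov (s z.1) fun j => Y j z.2)⁻¹ *ᵥ u)) * hsq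

end Consistency

end OneSample

/-! ### Wald statistics for functions of the quadratic form -/

section Groups

variable {Ω : Type*} [MeasurableSpace Ω] {P : Measure Ω} [IsProbabilityMeasure P]

/-- The sum of `V 0, …, V (n - 1)`, standardized under the assumption of mean zero. -/
noncomputable def stdSum (P : Measure Ω) (V : ℕ → Ω → ℝ) (n : ℕ) (ω : Ω) : ℝ :=
  (√n)⁻¹ * ∑ j ∈ Finset.range n, V j ω / √Var[V 0; P]

theorem measurable_stdSum {P : Measure Ω} {V : ℕ → Ω → ℝ} (hV : ∀ j, Measurable (V j)) (n : ℕ) :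
    Measurable (stdSum P V n) :=
  (Finset.measurable_sum _ fun j _ => (hV j).div_const _).const_mul _

/-- The central limit theorem along arbitrary sample sizes `s m → ∞`. -/
theorem IsIIDSample.tendstoInDistribution_stdSum {V : ℕ → Ω → ℝ} (hV : IsIIDSample P V)
    (hmean : ∫ ω, V 0 ω ∂P = 0) (hvar : 0 < Var[V 0; P])
    {s : ℕ → ℕ} (hs : Tendsto s atTop atTop) :
    TendstoInDistribution (fun m => stdSum P V (s m)) atTop (id : ℝ → ℝ) (fun _ => P)
      (gaussianReal 0 1) := by
  have hW := hV.comp (f := fun x => x / √Var[V 0; P]) (by fun_prop)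
  have h := tendstoInDistribution_inv_sqrt_mul_sum (P := P) (P' := gaussianReal 0 1)
    (X := fun j ω => V j ω / √Var[V 0; P]) (Y := id) ⟨aemeasurable_id, Measure.map_id⟩
    (by rw [integral_div, hmean, zero_div])
    (by
      simp only [Pi.pow_apply, div_pow]
      rw [integral_div, Real.sq_sqrt hvar.le]
      have := variance_of_integral_eq_zero (hV.measurable 0).aemeasurable hmean
      rw [← this, div_self hvar.ne']) hW.indep hW.ident
  exact ⟨fun m => h.forall_aemeasurable (s m), h.aemeasurable_limit, h.tendsto.comp hs⟩

theorem sqrt_mul_avg_eq {V : ℕ → Ω → ℝ} (hvar : 0 < Var[V 0; P]) {n : ℕ} (hn : n ≠ 0) (N : ℕ)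
    (ω : Ω) : √N * avg n (fun j => V j ω) = √((n : ℝ) / N)⁻¹ * √Var[V 0; P] * stdSum P V n ω := by
  have hn' : (0 : ℝ) < n := by exact_mod_cast Nat.pos_of_ne_zero hn
  have h1 := Real.sqrt_ne_zero'.2 hn'
  have h2 := Real.sqrt_ne_zero'.2 hvar
  rw [stdSum, avg, ← Finset.sum_div, inv_div, Real.sqrt_div (Nat.cast_nonneg N)]
  field_simp
  rw [Real.sq_sqrt hn'.le]
  ring

/-- The Wald statistic for the parameters `φ(qᵢ)`, where `qᵢ = μᵢᵀ Σᵢ⁻¹ μᵢ`. The function `J q` is the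
difference quotient of `φ` at `q`, so that the delta method becomes the exact identity
`φ a - φ q = J q a * (a - q)` with `J q` continuous at `q`; `var` is any estimator consistent for
`κᵢ⁻¹ φ'(qᵢ)² Var(influence)`. -/
theorem tendstoInDistribution_wald_of_empQuad {d k r : ℕ} {X : Fin k → ℕ → Ω → Fin d → ℝ}
    (hmeas : ∀ i j, Measurable (X i j))
    (hindep : iIndepFun (fun ij : Fin k × ℕ => X ij.1 ij.2) P)
    (hident : ∀ i j, IdentDistrib (X i j) (X i 0) P P)
    (hmom : ∀ i s, Integrable (fun ω => X i 0 ω s ^ 4) P)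
    (hmean : ∀ i, popMean P (X i 0) ≠ 0)
    (hcov : ∀ i, IsUnit (popCov P (X i 0)))
    (htwo : ∀ i s, ¬ IsCondTwoPoint P (X i 0) s)
    {n : ℕ → Fin k → ℕ} {κ : Fin k → ℝ}
    (hn : Tendsto (fun m => ∑ i, n m i) atTop atTop)
    (hκ : ∀ i, κ i ∈ Set.Ioo (0 : ℝ) 1)
    (hnκ : ∀ i, Tendsto (fun m => (n m i : ℝ) / ((∑ l, n m l : ℕ) : ℝ)) atTop (𝓝 (κ i)))
    {φ : ℝ → ℝ} {J : ℝ → ℝ → ℝ} (hφ : Measurable φ) (hJ : ∀ q, Measurable (J q))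
    (hJc : ∀ q, 0 < q → ContinuousAt (J q) q) (hJ0 : ∀ q, 0 < q → J q q ≠ 0)
    (hφJ : ∀ q a, 0 < q → 0 < a → φ a - φ q = J q a * (a - q))
    {var : ℕ → ℕ → (ℕ → Fin d → ℝ) → ℝ}
    (hvm : ∀ N n i, Measurable fun ω => var N n fun j => X i j ω)
    (hvar : ∀ i, Tendsto (fun m => n m i) atTop atTop →
      0 < quadForm (popMean P (X i 0)) (popCov P (X i 0)) →
      Tendsto (fun z : ℕ × Ω => var (∑ l, n z.1 l) (n z.1 i) fun j => X i j z.2) (probFilter P)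
      (𝓝 ((κ i)⁻¹ * J (quadForm (popMean P (X i 0)) (popCov P (X i 0)))
          (quadForm (popMean P (X i 0)) (popCov P (X i 0))) ^ 2 *
        Var[fun ω => influence (popMean P (X i 0) ᵥ* (popCov P (X i 0))⁻¹)
          (quadForm (popMean P (X i 0)) (popCov P (X i 0))) (X i 0 ω); P])))
    (M : Matrix (Fin r) (Fin k) ℝ)
    (hM : M *ᵥ (fun i => φ (quadForm (popMean P (X i 0)) (popCov P (X i 0)))) = 0) :
    TendstoInDistribution (fun m ω => wald (∑ l, n m l) M
        (diagonal fun i => var (∑ l, n m l) (n m i) fun j => X i j ω)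
        (fun i => φ (empQuad (n m i) fun j => X i j ω))) atTop
      (id : ℝ → ℝ) (fun _ => P) (chiSquare M.rank) := by
  have hX : ∀ i, IsIIDSample P (X i) := fun i =>
    ⟨hmeas i, hindep.precomp (g := fun j => (i, j)) fun a b h => congrArg Prod.snd h, hident i⟩
  set q : Fin k → ℝ := fun i => quadForm (popMean P (X i 0)) (popCov P (X i 0)) with hq
  set g : Fin k → (Fin d → ℝ) → ℝ := fun i =>
    influence (popMean P (X i 0) ᵥ* (popCov P (X i 0))⁻¹) (q i) with hg
  let V : Fin k → ℕ → Ω → ℝ := fun i j ω => g i (X i j ω)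
  have hgm : ∀ i, Measurable (g i) := fun i => measurable_influence _ _
  have hV : ∀ i, IsIIDSample P (V i) := fun i => (hX i).comp (hgm i)
  have hpos := fun i => quadForm_pos_and_variance_influence_pos (hmeas i 0) (hmom i) (hcov i)
    (hmean i) (htwo i)
  have hqpos : ∀ i, 0 < q i := fun i => (hpos i).1
  have hVpos : ∀ i, 0 < Var[V i 0; P] := fun i => (hpos i).2
  have hns : ∀ i, Tendsto (fun m => n m i) atTop atTop := fun i => by
    have h := (hnκ i).pos_mul_atTop (hκ i).1 (tendsto_natCast_atTop_atTop (R := ℝ).comp hn)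
    refine tendsto_natCast_atTop_iff.1 (tendsto_atTop_mono (fun m => ?_) h)
    simp only [Function.comp_apply]
    rcases eq_or_ne ((∑ l, n m l : ℕ) : ℝ) 0 with h0 | h0
    · rw [h0]; simp
    · exact (div_mul_cancel₀ _ h0).le
  have hquad := fun i => tendsto_empQuad (hX i) (hmom i) (hns i) (hcov i)
  have hJlim : ∀ i, Tendsto (fun z : ℕ × Ω => J (q i) (empQuad (n z.1 i) fun j => X i j z.2))
      (probFilter P) (𝓝 (J (q i) (q i))) := fun i => (hJc _ (hqpos i)).tendsto.comp (hquad i)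
  let c : Fin k → ℕ → ℝ := fun i m =>
    √((n m i : ℝ) / ((∑ l, n m l : ℕ) : ℝ))⁻¹ * √Var[V i 0; P]
  have hc : ∀ i, Tendsto (c i) atTop (𝓝 (√(κ i)⁻¹ * √Var[V i 0; P])) := fun i =>
    ((Real.continuous_sqrt.tendsto _).comp ((hnκ i).inv₀ (hκ i).1.ne')).mul_const _
  refine tendstoInDistribution_wald M (N := fun m => ∑ l, n m l)
    (v := fun m ω i => φ (empQuad (n m i) fun j => X i j ω))
    (S := fun m ω i => var (∑ l, n m l) (n m i) fun j => X i j ω)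
    (fun m i => hφ.comp (measurable_empQuad (hmeas i) _)) (fun m i => hvm _ _ i)
    (K := fun i => J (q i) (q i) * (√(κ i)⁻¹ * √Var[V i 0; P]))
    (fun i => mul_ne_zero (hJ0 _ (hqpos i)) (mul_ne_zero
      (Real.sqrt_ne_zero'.2 (inv_pos.2 (hκ i).1)) (Real.sqrt_ne_zero'.2 (hVpos i)))) hM
    (fun i => ?_) (G := fun i m => stdSum P (V i) (n m i))
    (fun i m => measurable_stdSum (hV i).measurable _) (fun m => ?_)
    (fun i => (hV i).tendstoInDistribution_stdSum
      (integral_influence (hmeas i 0) (hmom i) (hcov i)) (hVpos i) (hns i))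
    (J := fun i m ω => J (q i) (empQuad (n m i) fun j => X i j ω) * c i m)
    (fun i m => ((hJ _).comp (measurable_empQuad (hmeas i) _)).mul_const _)
    (fun i => (hJlim i).mul ((hc i).comp (tendsto_fst_probFilter P))) (fun i => ?_)
  · refine (hvar i (hns i) (hqpos i)).trans (le_of_eq (congrArg 𝓝 ?_))
    rw [mul_pow, mul_pow, Real.sq_sqrt (inv_pos.2 (hκ i).1).le, Real.sq_sqrt (hVpos i).le]
    ring
  · have hind := iIndepFun_curry hmeas hindep
    refine hind.comp (fun i (x : ℕ → Fin d → ℝ) =>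
      (√(n m i : ℝ))⁻¹ * ∑ j ∈ Finset.range (n m i), g i (x j) / √Var[V i 0; P]) fun i => ?_
    exact (Finset.measurable_sum _ fun j _ =>
      ((hgm i).comp (measurable_pi_apply j)).div_const _).const_mul _
  · have hlin := tendsto_empQuad_sub_avg_influence (hX i) (hmom i) (hns i) (hcov i) hn (hκ i).1 (hnκ i)
    have h := (hJlim i).mul hlin
    rw [mul_zero] at h
    refine h.congr' ?_
    filter_upwards [(tendsto_fst_probFilter P).eventually ((hns i).eventually_ne_atTop 0),
      (hquad i).eventually (lt_mem_nhds (hqpos i))] with z hz hz2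
    have e1 := sqrt_mul_avg_eq (V := V i) (hVpos i) hz (∑ l, n z.1 l) z.2
    have e2 := hφJ (q i) _ (hqpos i) hz2
    change J (q i) _ * (√_ * (_ - q i) - √_ * avg (n z.1 i) (fun j => V i j z.2)) = _
    rw [e1, e2]
    ring

end Groups

end MCV

open MCV
theorem theorem2 {Ω : Type*} [MeasurableSpace Ω] (P : Measure Ω) [IsProbabilityMeasure P]
    {d k r : ℕ}
    -- `X i j` is the random vector of individual `j` in group `i`
    (X : Fin k → ℕ → Ω → Fin d → ℝ)
    (hmeas : ∀ i j, Measurable (X i j))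
    (hindep : iIndepFun (fun ij : Fin k × ℕ => X ij.1 ij.2) P)
    (hident : ∀ i j, IdentDistrib (X i j) (X i 0) P P)
    (hmom : ∀ i s, Integrable (fun ω => X i 0 ω s ^ 4) P)
    (hmean : ∀ i, popMean P (X i 0) ≠ 0)
    (hcov : ∀ i, IsUnit (popCov P (X i 0)))
    (htwo : ∀ i s, ¬ IsCondTwoPoint P (X i 0) s)
    -- `n m i` is the size of group `i` at stage `m`
    (n : ℕ → Fin k → ℕ) (κ : Fin k → ℝ)
    (hn : Tendsto (fun m => ∑ i, n m i) atTop atTop)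
    (hκ : ∀ i, κ i ∈ Set.Ioo (0 : ℝ) 1)
    (hnκ : ∀ i, Tendsto (fun m => (n m i : ℝ) / ((∑ l, n m l : ℕ) : ℝ)) atTop (𝓝 (κ i)))
    (C B : Fin k → ℝ)
    (hC : ∀ i, C i = coefVar (popMean P (X i 0)) (popCov P (X i 0)))
    (hB : ∀ i, B i = stdMean (popMean P (X i 0)) (popCov P (X i 0)))
    (H : Matrix (Fin r) (Fin k) ℝ) (hH : H *ᵥ 1 = 0)
    (T : Matrix (Fin k) (Fin k) ℝ) (hT : T = projMat H) :
    -- the statistics based on the projection matrix `T`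
    (T *ᵥ C = 0 →
      TendstoInDistribution (fun m ω => waldC T (n m) (fun i j => X i j ω)) atTop
        (id : ℝ → ℝ) (fun _ => P) (chiSquare T.rank)) ∧
    (T *ᵥ B = 0 →
      TendstoInDistribution (fun m ω => waldB T (n m) (fun i j => X i j ω)) atTop
        (id : ℝ → ℝ) (fun _ => P) (chiSquare T.rank)) ∧
    -- the statistics based on the contrast matrix `H` itself
    (H *ᵥ C = 0 →
      TendstoInDistribution (fun m ω => waldC H (n m) (fun i j => X i j ω)) atTop
        (id : ℝ → ℝ) (fun _ => P) (chiSquare H.rank)) ∧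
    (H *ᵥ B = 0 →
      TendstoInDistribution (fun m ω => waldB H (n m) (fun i j => X i j ω)) atTop
        (id : ℝ → ℝ) (fun _ => P) (chiSquare H.rank)) := by
  -- derivatives of `1 / √q` and `√q` as difference quotients
  let JC : ℝ → ℝ → ℝ := fun q a => -(√a * √q * (√a + √q))⁻¹
  let JB : ℝ → ℝ → ℝ := fun q a => (√a + √q)⁻¹
  have hC' : C = fun i => 1 / √(quadForm (popMean P (X i 0)) (popCov P (X i 0))) := funext hC
  have hB' : B = fun i => √(quadForm (popMean P (X i 0)) (popCov P (X i 0))) := funext hB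
  have main_C : ∀ {p : ℕ} (M : Matrix (Fin p) (Fin k) ℝ), M *ᵥ C = 0 →
      TendstoInDistribution (fun m ω => waldC M (n m) (fun i j => X i j ω)) atTop
        (id : ℝ → ℝ) (fun _ => P) (chiSquare M.rank) := by
    intro p M hM
    refine tendstoInDistribution_wald_of_empQuad hmeas hindep hident hmom hmean hcov htwo hn hκ hnκ
      (φ := fun a => 1 / √a) (J := JC) (by fun_prop) (fun q => by fun_prop) (fun q hq => ?_)
      (fun q hq => ?_) (fun q a hq ha => ?_) (var := varC)
      (fun N n i => measurable_varC (hmeas i) N n) (fun i hs hq => ?_) M (hC' ▸ hM)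
    · have := Real.sqrt_pos.2 hq
      exact ContinuousAt.neg (ContinuousAt.inv₀ (by fun_prop) (by positivity))
    · have := Real.sqrt_pos.2 hq
      exact neg_ne_zero.2 (by positivity)
    · have h1 := Real.sqrt_pos.2 hq
      have h2 := Real.sqrt_pos.2 ha
      have h3 := Real.sq_sqrt hq.le
      have h4 := Real.sq_sqrt ha.le
      have h5 : a - q = (√a - √q) * (√a + √q) := by linear_combination h3 - h4
      simp only [JC]
      rw [h5]
      field_simp
      ring
    · have h := tendsto_varC (N := fun m => ∑ l, n m l)
        ⟨hmeas i, hindep.precomp (g := fun j => (i, j)) fun a b h => congrArg Prod.snd h, hident i⟩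
        (hmom i) hs (hcov i) hq (hκ i).1 (hnκ i)
      refine h.trans (le_of_eq (congrArg 𝓝 ?_))
      congr 1
      rw [mul_div_assoc]
      congr 1
      have h1 := Real.sqrt_pos.2 hq
      have h3 := Real.sq_sqrt hq.le
      set q := quadForm (popMean P (X i 0)) (popCov P (X i 0))
      simp only [JC]
      nth_rewrite 1 [← h3]
      field_simp
      ring
  have main_B : ∀ {p : ℕ} (M : Matrix (Fin p) (Fin k) ℝ), M *ᵥ B = 0 →
      TendstoInDistribution (fun m ω => waldB M (n m) (fun i j => X i j ω)) atTop
        (id : ℝ → ℝ) (fun _ => P) (chiSquare M.rank) := by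
    intro p M hM
    refine tendstoInDistribution_wald_of_empQuad hmeas hindep hident hmom hmean hcov htwo hn hκ hnκ
      (φ := fun a => √a) (J := JB) (by fun_prop) (fun q => by fun_prop) (fun q hq => ?_)
      (fun q hq => ?_) (fun q a hq ha => ?_) (var := varB)
      (fun N n i => measurable_varB (hmeas i) N n) (fun i hs hq => ?_) M (hB' ▸ hM)
    · have := Real.sqrt_pos.2 hq
      exact ContinuousAt.inv₀ (by fun_prop) (by positivity)
    · have := Real.sqrt_pos.2 hq
      exact inv_ne_zero (by positivity)
    · have h1 := Real.sqrt_pos.2 hq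
      have h2 := Real.sqrt_pos.2 ha
      have h3 := Real.sq_sqrt hq.le
      have h4 := Real.sq_sqrt ha.le
      simp only [JB]
      rw [eq_inv_mul_iff_mul_eq₀ (by positivity)]
      linear_combination h4 - h3
    · have h := tendsto_varB (N := fun m => ∑ l, n m l)
        ⟨hmeas i, hindep.precomp (g := fun j => (i, j)) fun a b h => congrArg Prod.snd h, hident i⟩
        (hmom i) hs (hcov i) hq (hκ i).1 (hnκ i)
      refine h.trans (le_of_eq (congrArg 𝓝 ?_))
      congr 1
      rw [mul_div_assoc]
      congr 1
      have h1 := Real.sqrt_pos.2 hq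
      have h3 := Real.sq_sqrt hq.le
      set q := quadForm (popMean P (X i 0)) (popCov P (X i 0))
      simp only [JB]
      nth_rewrite 1 [← h3]
      field_simp
      ring
  exact ⟨main_C T, main_B T, main_C H, main_B H⟩
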